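/- Let $V$ be a Hausdorff smooth manifold of finite dimension, with a $C^1$ Lorentzian metric $g$ of signature $(+,-,\dots,-)$ and a time orientation (a continuous vector field that is timelike everywhere). A vector $v$ is causal if $g(v,v)\ge 0$; a nonzero causal vector is future-directed if it lies in the same half of the cone as the time orientation. A covariant 2-tensor $T$ at a point is *future* if $T(u,v)\ge 0$ for all future-directed $u,v$. A *causal symmetry* is a diffeomorphism of $V$ whose differential maps every future-directed vector to a future-directed vector. Let $\xi$ be a smooth complete vector field on $V$, with one-parameter group $\{\varphi_s\}_{s\in\mathbb R}$. A *local submonoid of causal symmetries* generated by $\xi$ is a family $\{\varphi_s\}_{s\in J,\ s\ge 0}$ of causal symmetries, where $J\subset\mathbb R$ is an interval that contains $0$ and some positive number; $\xi$ is *causal preserving* if it generates one. The *canonical null directions* of the submonoid are the nonzero null vectors $k$ such that $\varphi_s' k$ is null for all $s\in J$, $s\ge 0$. Put $$\mu_\xi=\{k\in TV:\ k\neq 0,\ g(k,k)=0,\ (\pounds_\xi g)(k,k)=0\}.$$ Suppose that there is a function $\alpha:V\to\mathbb R$ such that $\pounds_\xi g-\alpha g$ is future at every point and has the same algebraic (Segre)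 type at all points; that is, for any two points some bijection of the eigenvalues, compatible with complex conjugation, matches the Jordan blocks of the associated endomorphisms $T^a{}_b$ and matches the real eigenspaces that contain timelike vectors, respectively nonzero null vectors. 1. If $\mu_\xi=\varnothing$, then $\xi$ is causal preserving, and none of the local submonoids of causal symmetries that it generates has canonical null directions. 2. Suppose that $\mu_\xi\neq\varnothing$ and that there is a $p$-form $\Omega$ on $V$, differentiable along $\xi$, such that at each point $x$ it is the wedge product $k_1^\flat\wedge\dots\wedge k_p^\flat$, with $k_i^\flat=g(k_i,\cdot)$, for some maximal linearly independent set $\{k_1,\dots,k_p\}$ of elements of $\mu_\xi\cap T_xV$, and such that $\pounds_\xi\Omega=\beta\,\Omega$ for some function $\beta:V\to\mathbb R$. Then $\xi$ is causal preserving, and for every local submonoid of causal symmetries that it generates the set of canonical null directions is $\mu_\xi$. -/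

import Mathlib

open scoped Manifold ContDiff Bundle TensorProduct

noncomputable section

namespace CausalSym

variable {E : Type*} [NormedAddCommGroup E] [NormedSpace ℝ E]
  {V : Type*} [TopologicalSpace V] [ChartedSpace E V]

/-- A `C^1` Lorentzian metric of signature `(+,-,…,-)` on a manifold `V` modelled on `E`: a symmetric
`C^1` section of the bundle of bilinear forms such that every tangent space contains a vector of
positive length on whose orthogonal complement the form is negative definite. -/
structure LorentzMetric (E : Type*) [NormedAddCommGroup E] [NormedSpace ℝ E]
    (V : Type*) [TopologicalSpace V] [ChartedSpace E V] [IsManifold 𝓘(ℝ, E) ∞ V] where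
  form : ∀ x : V, TangentSpace 𝓘(ℝ, E) x →L[ℝ] TangentSpace 𝓘(ℝ, E) x →L[ℝ] ℝ
  contMDiff_form : ContMDiff 𝓘(ℝ, E) (𝓘(ℝ, E).prod 𝓘(ℝ, E →L[ℝ] E →L[ℝ] ℝ)) 1
    (fun x ↦ Bundle.TotalSpace.mk' (E →L[ℝ] E →L[ℝ] ℝ)
      (E := fun x : V ↦ TangentSpace 𝓘(ℝ, E) x →L[ℝ] TangentSpace 𝓘(ℝ, E) x →L[ℝ] ℝ) x (form x))
  symm : ∀ x u v, form x u v = form x v u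
  lorentzian : ∀ x, ∃ u, 0 < form x u u ∧ ∀ v, form x u v = 0 → v ≠ 0 → form x v v < 0

/-- A time orientation of `(V, g)`: a continuous vector field that is timelike everywhere. -/
structure TimeOrientation [IsManifold 𝓘(ℝ, E) ∞ V] (g : LorentzMetric E V) where
  field : ∀ x : V, TangentSpace 𝓘(ℝ, E) x
  continuous_field : Continuous (fun x ↦ (⟨x, field x⟩ : TangentBundle 𝓘(ℝ, E) V))
  timelike : ∀ x, 0 < g.form x (field x) (field x)

/-- `φ` is the one-parameter group generated by the vector field `ξ`: for every `x` the curve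
`s ↦ φ_s(x)` is an integral curve of `ξ`, defined on the whole real line, that starts at `x`. Such a
`φ` exists precisely when `ξ` is complete. -/
structure IsFlow (ξ : ∀ x : V, TangentSpace 𝓘(ℝ, E) x) (φ : ℝ → V → V) : Prop where
  map_zero : ∀ x, φ 0 x = x
  isMIntegralCurve : ∀ x, IsMIntegralCurve (I := 𝓘(ℝ, E)) (fun s ↦ φ s x) ξ

/-- The differential of a map `f : V → V` at `x`. -/
abbrev push (f : V → V) (x : V) :
    TangentSpace 𝓘(ℝ, E) x →L[ℝ] TangentSpace 𝓘(ℝ, E) (f x) :=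
  mfderiv 𝓘(ℝ, E) 𝓘(ℝ, E) f x

section Metric

variable [IsManifold 𝓘(ℝ, E) ∞ V]

/-- A causal vector `v` (that is, `g(v,v) ≥ 0`) which is future directed. -/
def IsFutureDirected (g : LorentzMetric E V) (τ : TimeOrientation g) (x : V)
    (v : TangentSpace 𝓘(ℝ, E) x) : Prop :=
  0 ≤ g.form x v v ∧ 0 < g.form x (τ.field x) v

/-- A rank-2 covariant tensor at `x` is future if it is nonnegative on future-directed vectors. -/
def IsFutureTensor (g : LorentzMetric E V) (τ : TimeOrientation g) (x : V)
    (T : TangentSpace 𝓘(ℝ, E) x → TangentSpace 𝓘(ℝ, E) x → ℝ) : Prop :=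
  ∀ u v, IsFutureDirected g τ x u → IsFutureDirected g τ x v → 0 ≤ T u v

/-- Causal symmetries: diffeomorphisms of `V` mapping future-directed vectors to future-directed
vectors. -/
def IsCausalSymmetry (g : LorentzMetric E V) (τ : TimeOrientation g) (f : V → V) : Prop :=
  (∃ Φ : V ≃ₘ^∞⟮𝓘(ℝ, E), 𝓘(ℝ, E)⟯ V, ⇑Φ = f) ∧
    ∀ x v, IsFutureDirected g τ x v → IsFutureDirected g τ (f x) (push f x v)

/-- `J` is an interval of the real line containing zero and some positive number, and
`φ_s` is a causal symmetry for every `s ∈ J` with `s ≥ 0`. -/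
def IsCausalSubmonoid (g : LorentzMetric E V) (τ : TimeOrientation g) (φ : ℝ → V → V)
    (J : Set ℝ) : Prop :=
  J.OrdConnected ∧ 0 ∈ J ∧ (∃ s ∈ J, 0 < s) ∧ ∀ s ∈ J, 0 ≤ s → IsCausalSymmetry g τ (φ s)

/-- The (complete) vector field `ξ` is causal preserving: it generates a local one-parameter
submonoid of causal symmetries. -/
def IsCausalPreserving (g : LorentzMetric E V) (τ : TimeOrientation g)
    (ξ : ∀ x : V, TangentSpace 𝓘(ℝ, E) x) : Prop :=
  ∃ φ, IsFlow ξ φ ∧ ∃ J, IsCausalSubmonoid g τ φ J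

/-- The canonical null directions of the submonoid `{φ_s : s ∈ J, s ≥ 0}`: the nonzero null vectors
that stay null under all its mappings. -/
def canonicalNullDirections (g : LorentzMetric E V) (φ : ℝ → V → V) (J : Set ℝ) :
    Set (TangentBundle 𝓘(ℝ, E) V) :=
  {k | k.2 ≠ 0 ∧ g.form k.1 k.2 k.2 = 0 ∧ ∀ s ∈ J, 0 ≤ s →
    g.form (φ s k.1) (push (φ s) k.1 k.2) (push (φ s) k.1 k.2) = 0}

/-- The Lie derivative of the metric along the vector field with flow `φ`: the derivative at `s = 0`
of the pulled back metric `φ_s^* g`. -/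
def lieMetric (g : LorentzMetric E V) (φ : ℝ → V → V) (x : V)
    (u v : TangentSpace 𝓘(ℝ, E) x) : ℝ :=
  deriv (fun s : ℝ ↦ g.form (φ s x) (push (φ s) x u) (push (φ s) x v)) 0

/-- The set `μ_ξ` of nonzero null vectors `k` with `(£_ξ g)(k,k) = 0`, where `φ` is the flow
of `ξ`. -/
def muSet (g : LorentzMetric E V) (φ : ℝ → V → V) : Set (TangentBundle 𝓘(ℝ, E) V) :=
  {k | k.2 ≠ 0 ∧ g.form k.1 k.2 k.2 = 0 ∧ lieMetric g φ k.1 k.2 k.2 = 0}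

/-- A `p`-form which at every point is the wedge product of (the metric duals of) a maximal
linearly independent family of elements of `μ_ξ`. The wedge product of one-forms `θ_1, …, θ_p` is
`(v_1, …, v_p) ↦ det (θ_i (v_j))`. -/
def IsWedgeOfMu (g : LorentzMetric E V) (φ : ℝ → V → V) {p : ℕ}
    (Ω : ∀ x : V, TangentSpace 𝓘(ℝ, E) x [⋀^Fin p]→L[ℝ] ℝ) : Prop :=
  ∀ x, ∃ k : Fin p → TangentSpace 𝓘(ℝ, E) x,
    (∀ i, (⟨x, k i⟩ : TangentBundle 𝓘(ℝ, E) V) ∈ muSet g φ) ∧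
    LinearIndependent ℝ k ∧
    (∀ v : TangentSpace 𝓘(ℝ, E) x, (⟨x, v⟩ : TangentBundle 𝓘(ℝ, E) V) ∈ muSet g φ →
      v ∈ Submodule.span ℝ (Set.range k)) ∧
    ∀ v : Fin p → TangentSpace 𝓘(ℝ, E) x,
      Ω x v = (Matrix.of fun i j ↦ g.form x (k i) (v j)).det

end Metric

/-- `£_ξ Ω ∝ Ω`: the `p`-form `Ω` has a Lie derivative along the vector field with flow `φ` (the
derivative of `φ_s^* Ω` at `s = 0`), and it is a multiple of `Ω` at every point. -/
def LieProportional (φ : ℝ → V → V) {p : ℕ}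
    (Ω : ∀ x : V, TangentSpace 𝓘(ℝ, E) x [⋀^Fin p]→L[ℝ] ℝ) : Prop :=
  ∃ β : V → ℝ, ∀ (x : V) (v : Fin p → TangentSpace 𝓘(ℝ, E) x),
    HasDerivAt (fun s : ℝ ↦ Ω (φ s x) (fun i ↦ push (φ s) x (v i))) (β x * Ω x v) 0

section AlgebraicType

variable [IsManifold 𝓘(ℝ, E) ∞ V]

/-- `A` is the endomorphism obtained from the rank-2 covariant tensor `T` by raising an index. -/
def IsRaised (g : LorentzMetric E V) (x : V)
    (T : TangentSpace 𝓘(ℝ, E) x → TangentSpace 𝓘(ℝ, E) x → ℝ)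
    (A : Module.End ℝ (TangentSpace 𝓘(ℝ, E) x)) : Prop :=
  ∀ u v, g.form x (A u) v = T u v

/-- The dimension of the kernel of `(A - z)^m` on the complexified tangent space. For all `z` and
`m` together these numbers are the sizes of the Jordan blocks of `A`. -/
def jordanDim {x : V} (A : Module.End ℝ (TangentSpace 𝓘(ℝ, E) x)) (z : ℂ) (m : ℕ) : ℕ :=
  Module.finrank ℂ (LinearMap.ker
    (((LinearMap.baseChange ℂ A : Module.End ℂ (ℂ ⊗[ℝ] TangentSpace 𝓘(ℝ, E) x)) -
      algebraMap ℂ (Module.End ℂ (ℂ ⊗[ℝ] TangentSpace 𝓘(ℝ, E) x)) z) ^ m))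

/-- Rank-2 covariant tensors `T` at `x` and `S` at `y` have the same algebraic (Segre) type: after a
relabelling `σ` of the eigenvalues that respects complex conjugation, their mixed versions have the
same Jordan blocks, and corresponding real eigenspaces agree as to whether they contain timelike
vectors and whether they contain null directions. -/
def SameAlgebraicType (g : LorentzMetric E V) (x y : V)
    (T : TangentSpace 𝓘(ℝ, E) x → TangentSpace 𝓘(ℝ, E) x → ℝ)
    (S : TangentSpace 𝓘(ℝ, E) y → TangentSpace 𝓘(ℝ, E) y → ℝ) : Prop :=
  ∃ A B, IsRaised g x T A ∧ IsRaised g y S B ∧ ∃ σ : ℂ ≃ ℂ,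
    (∀ z, σ (starRingEnd ℂ z) = starRingEnd ℂ (σ z)) ∧
    (∀ z m, jordanDim A z m = jordanDim B (σ z) m) ∧
    ∀ a b : ℝ, σ a = b →
      ((∃ v, 0 < g.form x v v ∧ A v = a • v) ↔ ∃ w, 0 < g.form y w w ∧ B w = b • w) ∧
      ((∃ v, v ≠ 0 ∧ g.form x v v = 0 ∧ A v = a • v) ↔
        ∃ w, w ≠ 0 ∧ g.form y w w = 0 ∧ B w = b • w)

end AlgebraicType

end CausalSym

end

open scoped Manifold ContDiff Bundle TensorProduct
open Set Filter Topology

/-! Fix `x` and pull the metric back along the flow: `B s = φ_s^* g` is a `C¹` curve of Lorentzian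
forms on the one space `T_xV`, and `B' s = φ_s^*(£_ξ g)`. On null vectors the term `α g` vanishes,
so the future condition gives `B' ≥ 0` on the null cone of `B`. By `add_nonneg_of_nonneg_on_null`
this yields `B'(v,v) ≥ M B(v,v)` for spacelike `v`, with `M` locally bounded, and a comparison
argument (`nonneg_of_mul_le_deriv`) keeps causal vectors causal for `s ≥ 0`. Continuity preserves
their time direction, so `ξ` is causal preserving.

A canonical null direction makes `B s k k` vanish on some `[0, ε]`, so its derivative at `0`
vanishes and `k ∈ μ_ξ`. This settles the case of empty `μ_ξ`.

Conversely, `£_ξ Ω = β Ω` fixes the kernel `N` of `φ_s^* Ω`, which is the `B s`-orthogonal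
complement of the span `W s` of the pulled back `μ_ξ`. If `W s` is a null line, orthogonality
suffices. Otherwise `W s` contains timelike vectors, the S-lemma gives `B' ≥ a B`, and common null
vectors are eigenvectors, so `B'(w,·) = a B(w,·)` on `W s`. Grönwall's inequality applied to `B s k`
restricted to `N` keeps `k` in `W s`; then `(B(k,k))' = a B(k,k)`, and `B(k,k)` stays zero.

Joint smoothness of the flow, needed for `B` to be `C¹`, comes from the inverse function theorem on
a space of curves. -/

namespace CausalSym

/-! ### Smoothness of superposition operators on spaces of continuous curves. -/

section Superposition

universe u

variable {K : Type*} [TopologicalSpace K] [CompactSpace K]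
  {E : Type*} [NormedAddCommGroup E] [NormedSpace ℝ E]
  {F : Type*} [NormedAddCommGroup F] [NormedSpace ℝ F]

/-- Pointwise application of a continuous bilinear map to continuous curves. -/
noncomputable def pointwiseBilin (K : Type*) [TopologicalSpace K] [CompactSpace K]
    {E F G : Type*} [NormedAddCommGroup E] [NormedSpace ℝ E] [NormedAddCommGroup F]
    [NormedSpace ℝ F] [NormedAddCommGroup G] [NormedSpace ℝ G] (A : G →L[ℝ] E →L[ℝ] F) :
    C(K, G) →L[ℝ] C(K, E) →L[ℝ] C(K, F) :=
  LinearMap.mkContinuous₂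
    (LinearMap.mk₂ ℝ
      (fun (a : C(K, G)) (h : C(K, E)) ↦
        (⟨fun t ↦ A (a t) (h t), (A.continuous.comp a.continuous).clm_apply h.continuous⟩ :
          C(K, F)))
      (fun _ _ _ ↦ by ext; simp) (fun _ _ _ ↦ by ext; simp)
      (fun _ _ _ ↦ by ext; simp) (fun _ _ _ ↦ by ext; simp))
    ‖A‖ (fun a h ↦ by
      rw [ContinuousMap.norm_le _ (by positivity)]
      intro t
      exact (A.le_opNorm₂ (a t) (h t)).trans (by
        gcongr
        · exact a.norm_coe_le_norm t
        · exact h.norm_coe_le_norm t))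

/-- The mean value inequality on the segment from `γ t` to `γ t + η t` bounds the remainder;
continuity of `γ ↦ f' ∘ γ` in the sup norm makes the bound uniform in `t`. -/
theorem hasFDerivAt_postcomp {G : Type*} [NormedAddCommGroup G] [NormedSpace ℝ G]
    (A : G →L[ℝ] E →L[ℝ] F) {f : E → F} {f' : E → G} (hf : Continuous f)
    (hf' : Continuous f') (h : ∀ x, HasFDerivAt f (A (f' x)) x) (γ : C(K, E)) :
    HasFDerivAt (fun γ : C(K, E) ↦ (⟨f, hf⟩ : C(E, F)).comp γ)
      (pointwiseBilin K A ((⟨f', hf'⟩ : C(E, G)).comp γ)) γ := by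
  rw [hasFDerivAt_iff_isLittleO_nhds_zero, Asymptotics.isLittleO_iff]
  intro ε hε
  have hc := ContinuousMap.continuous_postcomp (X := K) (⟨f', hf'⟩ : C(E, G))
  obtain ⟨δ, hδ, H⟩ := Metric.continuous_iff.1 hc γ (ε / (‖A‖ + 1)) (by positivity)
  filter_upwards [Metric.ball_mem_nhds (0 : C(K, E)) hδ] with η hη
  rw [mem_ball_zero_iff] at hη
  rw [ContinuousMap.norm_le _ (by positivity)]
  intro t
  have key := Convex.norm_image_sub_le_of_norm_hasFDerivWithin_le' (𝕜 := ℝ) (f := f)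
    (f' := fun x ↦ A (f' x)) (φ := A (f' (γ t))) (C := ε) (s := segment ℝ (γ t) (γ t + η t))
    (x := γ t) (y := γ t + η t) (fun x _ ↦ (h x).hasFDerivWithinAt) ?_ (convex_segment _ _)
    (left_mem_segment _ _ _) (right_mem_segment _ _ _)
  · rw [add_sub_cancel_left] at key
    exact key.trans (mul_le_mul_of_nonneg_left (η.norm_coe_le_norm t) hε.le)
  · intro z hz
    rw [segment_eq_image'] at hz
    obtain ⟨θ, ⟨h0, h1⟩, rfl⟩ := hz
    have h2 : dist (γ + θ • η) γ < δ := by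
      rw [dist_eq_norm, add_sub_cancel_left, norm_smul, Real.norm_of_nonneg h0]
      exact (mul_le_of_le_one_left (norm_nonneg _) h1).trans_lt hη
    have h3 := H _ h2
    rw [dist_eq_norm] at h3
    have h4 := (ContinuousMap.norm_coe_le_norm _ t).trans h3.le
    have h5 : ‖f' (γ t + θ • η t) - f' (γ t)‖ ≤ ε / (‖A‖ + 1) := by simpa using h4
    rw [add_sub_cancel_left, ← map_sub]
    calc _ ≤ ‖A‖ * (ε / (‖A‖ + 1)) := (A.le_opNorm _).trans (by gcongr)
      _ ≤ (‖A‖ + 1) * (ε / (‖A‖ + 1)) := by gcongr; linarith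
      _ = ε := by field_simp

/-- The derivative is again a superposition operator, with `f'` in place of `f`, so the induction
must range over all targets `F`. -/
theorem contDiff_nat_postcomp {E : Type u} [NormedAddCommGroup E] [NormedSpace ℝ E] (n : ℕ) :
    ∀ {F : Type u} [NormedAddCommGroup F] [NormedSpace ℝ F] {f : E → F} (hf : ContDiff ℝ n f),
      ContDiff ℝ n (fun γ : C(K, E) ↦ (⟨f, hf.continuous⟩ : C(E, F)).comp γ) := by
  induction n with
  | zero =>
    intro F _ _ f hf
    exact contDiff_zero.2 (ContinuousMap.continuous_postcomp _)
  | succ n ih =>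
    intro F _ _ f hf
    have hf₁ := hf
    push_cast at hf₁ ⊢
    obtain ⟨f', hf', h⟩ := contDiff_succ_iff_hasFDerivAt.1 hf₁
    exact contDiff_succ_iff_hasFDerivAt.2 ⟨_,
      (pointwiseBilin K (ContinuousLinearMap.id ℝ (E →L[ℝ] F))).contDiff.comp (ih hf'),
      fun γ ↦ hasFDerivAt_postcomp (ContinuousLinearMap.id ℝ (E →L[ℝ] F)) hf.continuous
        hf'.continuous h γ⟩

/-- Superposition with a smooth map is smooth on the Banach space of continuous curves. -/
theorem contDiff_postcomp {E : Type u} [NormedAddCommGroup E] [NormedSpace ℝ E]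
    {F : Type u} [NormedAddCommGroup F] [NormedSpace ℝ F] {f : E → F} (hf : ContDiff ℝ ∞ f) :
    ContDiff ℝ ∞ (fun γ : C(K, E) ↦ (⟨f, hf.continuous⟩ : C(E, F)).comp γ) :=
  contDiff_infty.2 fun n ↦ contDiff_nat_postcomp n (contDiff_infty.1 hf n)

end Superposition

/-! ### Smooth local flows on a Banach space. -/

section LocalFlow

variable {E : Type*} [NormedAddCommGroup E] [NormedSpace ℝ E] [CompleteSpace E]

/-- The primitive vanishing at zero of a continuous curve on `[-2, 2]`. -/
noncomputable def primitive (E : Type*) [NormedAddCommGroup E] [NormedSpace ℝ E]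
    [CompleteSpace E] : C(Icc (-2 : ℝ) 2, E) →L[ℝ] C(Icc (-2 : ℝ) 2, E) :=
  LinearMap.mkContinuous
    { toFun := fun u ↦ ⟨fun t ↦ ∫ r in (0 : ℝ)..t, IccExtend (by norm_num : (-2 : ℝ) ≤ 2) u r, by
        have hu : Continuous (IccExtend (by norm_num : (-2 : ℝ) ≤ 2) u) := u.continuous.Icc_extend'
        exact (intervalIntegral.continuous_primitive
          (fun a b ↦ hu.intervalIntegrable a b) 0).comp continuous_subtype_val⟩
      map_add' := fun u v ↦ by
        have hu : Continuous (IccExtend (by norm_num : (-2 : ℝ) ≤ 2) u) := u.continuous.Icc_extend'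
        have hv : Continuous (IccExtend (by norm_num : (-2 : ℝ) ≤ 2) v) := v.continuous.Icc_extend'
        ext t
        exact intervalIntegral.integral_add (hu.intervalIntegrable _ _) (hv.intervalIntegrable _ _)
      map_smul' := fun c u ↦ by
        ext t
        exact intervalIntegral.integral_smul c _ }
    2 (fun u ↦ by
      rw [ContinuousMap.norm_le _ (by positivity)]
      intro t
      refine (intervalIntegral.norm_integral_le_of_norm_le_const (C := ‖u‖)
        fun r _ ↦ u.norm_coe_le_norm _).trans ?_
      rw [sub_zero, mul_comm]
      exact mul_le_mul_of_nonneg_right (abs_le.2 t.2) (norm_nonneg _))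

theorem primitive_apply (u : C(Icc (-2 : ℝ) 2, E)) (t : Icc (-2 : ℝ) 2) :
    primitive E u t = ∫ r in (0 : ℝ)..t, IccExtend (by norm_num : (-2 : ℝ) ≤ 2) u r := rfl

/-- A smooth vector field on a Banach space has a smooth local flow: for `(τ, x)` near `(0, x₀)`,
`ψ (τ, x)` is the value at time `1` of a curve from `x` that is tangent to `τ • f`. -/
theorem exists_contDiffAt_localFlow {f : E → E} (hf : ContDiff ℝ ∞ f) (x₀ : E) {U : Set E}
    (hU : U ∈ 𝓝 x₀) :
    ∃ ψ : ℝ × E → E, ContDiffAt ℝ ∞ ψ (0, x₀) ∧ ∀ᶠ q in 𝓝 ((0 : ℝ), x₀), ∃ γ : ℝ → E,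
      γ 0 = q.2 ∧ γ 1 = ψ q ∧ ∀ t ∈ Ioo (-2 : ℝ) 2, γ t ∈ U ∧ HasDerivAt γ (q.1 • f (γ t)) t := by
  -- The interval has both `0` and `1` in its interior, so that uniqueness of integral curves on
  -- `(-2, 2)` can later compare values at time `1`.
  set K := Icc (-2 : ℝ) 2
  set S : C(K, E) → C(K, E) := fun γ ↦ (⟨f, hf.continuous⟩ : C(E, E)).comp γ with hS
  have hSd : ContDiff ℝ ∞ S := contDiff_postcomp hf
  -- `Ψ (τ, γ) = (τ, const x)` is the integral equation of `γ' = τ f(γ)`, `γ 0 = x`. Inverting `Ψ`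
  -- solves it smoothly in `τ` and `x`; at `τ = 0` its derivative is the shear `Λ`.
  set Ψ : ℝ × C(K, E) → ℝ × C(K, E) := fun p ↦ (p.1, p.2 - p.1 • primitive E (S p.2)) with hΨ
  have hPd : ContDiff ℝ ∞ fun p : ℝ × C(K, E) ↦ primitive E (S p.2) :=
    (primitive E).contDiff.comp (hSd.comp contDiff_snd)
  have hΨd : ContDiff ℝ ∞ Ψ := contDiff_fst.prodMk (contDiff_snd.sub (contDiff_fst.smul hPd))
  set c : E →L[ℝ] C(K, E) := ContinuousLinearMap.const ℝ K with hc
  set γ₀ : C(K, E) := c x₀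
  set a : ℝ × C(K, E) := (0, γ₀)
  let Λ : (ℝ × C(K, E)) ≃L[ℝ] ℝ × C(K, E) :=
    (ContinuousLinearEquiv.refl ℝ ℝ).skewProd (ContinuousLinearEquiv.refl ℝ _)
      (-(ContinuousLinearMap.toSpanSingleton ℝ (primitive E (S γ₀))))
  have hΛ : HasFDerivAt Ψ (Λ : (ℝ × C(K, E)) →L[ℝ] ℝ × C(K, E)) a := by
    have h1 := ((hPd.differentiable (by simp)) a).hasFDerivAt
    have h2 := (hasFDerivAt_fst (𝕜 := ℝ) (p := a)).prodMk
      ((hasFDerivAt_snd (𝕜 := ℝ) (p := a)).sub ((hasFDerivAt_fst (𝕜 := ℝ) (p := a)).smul h1))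
    refine h2.congr_fderiv ?_
    ext p <;> simp [Λ, a, ContinuousLinearEquiv.skewProd_apply]
  have ha : Ψ a = a := by simp [Ψ, a]
  have hn : (∞ : WithTop ℕ∞) ≠ 0 := by simp
  set inv := hΨd.contDiffAt.localInverse hΛ hn with hinv
  have hinvd : ContDiffAt ℝ ∞ inv a := by
    have := hΨd.contDiffAt.to_localInverse hΛ hn
    rwa [ha] at this
  have hright : ∀ᶠ y in 𝓝 a, Ψ (inv y) = y := by
    have := (hΨd.contDiffAt.hasStrictFDerivAt' hΛ hn).eventually_right_inverse
    rwa [ha] at this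
  have hinva : inv a = a := by
    have := (hΨd.contDiffAt.hasStrictFDerivAt' hΛ hn).localInverse_apply_image
    rwa [ha] at this
  set j : ℝ × E → ℝ × C(K, E) := fun q ↦ (q.1, c q.2) with hj
  have hjd : ContDiff ℝ ∞ j := contDiff_fst.prodMk (c.contDiff.comp contDiff_snd)
  have hja : j (0, x₀) = a := rfl
  let ev : C(K, E) →L[ℝ] E := ContinuousMap.evalCLM ℝ (⟨1, by constructor <;> norm_num⟩ : K)
  have hcomp : ContDiffAt ℝ ∞ (fun q ↦ (inv (j q)).2) (0, x₀) :=
    contDiffAt_snd.comp _ (ContDiffAt.comp (0, x₀) (by rw [hja]; exact hinvd) hjd.contDiffAt)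
  refine ⟨fun q ↦ ev (inv (j q)).2, ev.contDiff.contDiffAt.comp _ hcomp, ?_⟩
  obtain ⟨r, hr, hrU⟩ := Metric.mem_nhds_iff.1 hU
  have hnear : ∀ᶠ q in 𝓝 ((0 : ℝ), x₀), (inv (j q)).2 ∈ Metric.ball γ₀ r := by
    have h := hcomp.continuousAt
    have h0 : (inv (j (0, x₀))).2 = γ₀ := by rw [hja, hinva]
    have h3 := h.tendsto
    simp only [h0] at h3
    exact h3 (Metric.ball_mem_nhds γ₀ hr)
  have hright' : ∀ᶠ q in 𝓝 ((0 : ℝ), x₀), Ψ (inv (j q)) = j q :=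
    hjd.continuous.continuousAt.eventually (by rw [hja]; exact hright)
  filter_upwards [hnear, hright'] with q hq hq'
  set γ := (inv (j q)).2
  have h1 : (inv (j q)).1 = q.1 := congrArg Prod.fst hq'
  have h2 : ∀ t : K, γ t = q.2 + q.1 • primitive E (S γ) t := by
    intro t
    have h3 : (inv (j q)).2 t - (inv (j q)).1 • primitive E (S (inv (j q)).2) t = q.2 :=
      congrArg (fun p ↦ p.2 t) hq'
    rw [h1] at h3
    exact sub_eq_iff_eq_add.1 h3
  have hle : (-2 : ℝ) ≤ 2 := by norm_num
  have hext : ∀ t ∈ K, IccExtend hle γ t =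
      q.2 + q.1 • ∫ r in (0 : ℝ)..t, f (IccExtend hle γ r) := by
    intro t ht
    rw [IccExtend_of_mem hle γ ht, h2, primitive_apply]
    rfl
  refine ⟨IccExtend hle γ, ?_, ?_, ?_⟩
  · rw [hext 0 (by constructor <;> norm_num)]
    simp
  · exact IccExtend_of_mem hle γ (by constructor <;> norm_num)
  · intro t ht
    have hmem := Ioo_subset_Icc_self ht
    constructor
    · apply hrU
      rw [IccExtend_of_mem hle γ hmem]
      exact (ContinuousMap.dist_apply_le_dist (f := γ) (g := γ₀) ⟨t, hmem⟩).trans_lt hq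
    · have hcont : Continuous fun r ↦ f (IccExtend hle γ r) :=
        hf.continuous.comp γ.continuous.Icc_extend'
      have := ((hcont.integral_hasStrictDerivAt 0 t).hasDerivAt.const_smul q.1).const_add q.2
      refine this.congr_of_eventuallyEq ?_
      filter_upwards [Icc_mem_nhds ht.1 ht.2] with r hr
      exact hext r hr

end LocalFlow

/-! ### Joint smoothness of the flow on the manifold. -/

section Flow

variable {E : Type*} [NormedAddCommGroup E] [NormedSpace ℝ E]
  {V : Type*} [TopologicalSpace V] [ChartedSpace E V] [IsManifold 𝓘(ℝ, E) ∞ V]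
  {ξ : ∀ x : V, TangentSpace 𝓘(ℝ, E) x} {φ : ℝ → V → V}

/-- The representative of a vector field in the chart at `x₀`. -/
noncomputable def chartField (ξ : ∀ x : V, TangentSpace 𝓘(ℝ, E) x) (x₀ : V) (y : E) : E :=
  tangentCoordChange 𝓘(ℝ, E) ((extChartAt 𝓘(ℝ, E) x₀).symm y) x₀
    ((extChartAt 𝓘(ℝ, E) x₀).symm y) (ξ ((extChartAt 𝓘(ℝ, E) x₀).symm y))

theorem contDiffOn_chartField
    (hξ : ContMDiff 𝓘(ℝ, E) 𝓘(ℝ, E).tangent ∞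
      (fun x ↦ (⟨x, ξ x⟩ : TangentBundle 𝓘(ℝ, E) V))) (x₀ : V) :
    ContDiffOn ℝ ∞ (chartField ξ x₀) (extChartAt 𝓘(ℝ, E) x₀).target := by
  have h := (contMDiff_iff.1 hξ).2 x₀ ⟨x₀, ξ x₀⟩
  have h2 := contDiff_snd.comp_contDiffOn h
  refine h2.mono fun y hy ↦ ⟨hy, ?_⟩
  have := (extChartAt 𝓘(ℝ, E) x₀).map_target hy
  simpa [mfld_simps] using this

/-- A curve in the chart at `x₀` tangent to the representative of `ξ` is an integral curve. -/
theorem hasMFDerivAt_extChartAt_symm_comp {x₀ : V} {γ : ℝ → E} {t : ℝ}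
    (hmem : γ t ∈ (extChartAt 𝓘(ℝ, E) x₀).target)
    (h : HasDerivAt γ (chartField ξ x₀ (γ t)) t) :
    HasMFDerivAt 𝓘(ℝ, ℝ) 𝓘(ℝ, E) ((extChartAt 𝓘(ℝ, E) x₀).symm ∘ γ) t
      ((1 : ℝ →L[ℝ] ℝ).smulRight (ξ (((extChartAt 𝓘(ℝ, E) x₀).symm ∘ γ) t))) := by
  have : IsManifold 𝓘(ℝ, E) 1 V := IsManifold.of_le (n := ∞) (by simp)
  let xₜ : V := (extChartAt 𝓘(ℝ, E) x₀).symm (γ t)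
  have hft1 : xₜ ∈ (extChartAt 𝓘(ℝ, E) x₀).source := (extChartAt 𝓘(ℝ, E) x₀).map_target hmem
  have hft2 := mem_extChartAt_source (I := 𝓘(ℝ, E)) xₜ
  suffices hd : HasDerivAt ((extChartAt 𝓘(ℝ, E) xₜ ∘ (extChartAt 𝓘(ℝ, E) x₀).symm) ∘ γ)
      (ξ xₜ) t from
    ⟨(continuousAt_extChartAt_symm'' hmem).comp h.continuousAt,
      hd.hasDerivWithinAt.hasFDerivWithinAt⟩
  have hξt : tangentCoordChange 𝓘(ℝ, E) x₀ xₜ xₜ (chartField ξ x₀ (γ t)) = ξ xₜ :=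
    (tangentCoordChange_comp (x := x₀) ⟨⟨hft2, hft1⟩, hft2⟩).trans (tangentCoordChange_self hft2)
  have hD : HasFDerivAt (extChartAt 𝓘(ℝ, E) xₜ ∘ (extChartAt 𝓘(ℝ, E) x₀).symm)
      (tangentCoordChange 𝓘(ℝ, E) x₀ xₜ xₜ) (γ t) := by
    apply HasFDerivWithinAt.hasFDerivAt (s := range 𝓘(ℝ, E)) _ (by simp)
    rw [← (extChartAt 𝓘(ℝ, E) x₀).right_inv hmem]
    exact hasFDerivWithinAt_tangentCoordChange ⟨hft1, hft2⟩
  have hd := hD.comp_hasDerivAt t h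
  rwa [hξt] at hd

/-- Near a point of a chart the representative of a smooth vector field agrees with a smooth
vector field on the whole model space. -/
theorem exists_contDiff_eqOn_chartField [FiniteDimensional ℝ E]
    (hξ : ContMDiff 𝓘(ℝ, E) 𝓘(ℝ, E).tangent ∞
      (fun x ↦ (⟨x, ξ x⟩ : TangentBundle 𝓘(ℝ, E) V))) (x₀ : V) :
    ∃ f : E → E, ContDiff ℝ ∞ f ∧ ∃ U ∈ 𝓝 (extChartAt 𝓘(ℝ, E) x₀ x₀),
      U ⊆ (extChartAt 𝓘(ℝ, E) x₀).target ∧ EqOn f (chartField ξ x₀) U := by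
  have hopen : IsOpen (extChartAt 𝓘(ℝ, E) x₀).target := isOpen_extChartAt_target x₀
  obtain ⟨r, hr, hsub⟩ := Metric.nhds_basis_closedBall.mem_iff.1
    (hopen.mem_nhds (mem_extChartAt_target (I := 𝓘(ℝ, E)) x₀))
  -- The cut-off produces a field on all of `E`, as superposition with arbitrary curves requires.
  let χ : ContDiffBump (extChartAt 𝓘(ℝ, E) x₀ x₀) := ⟨r / 2, r, by positivity, by linarith⟩
  have hχ : tsupport χ ⊆ (extChartAt 𝓘(ℝ, E) x₀).target := by
    rw [χ.tsupport_eq]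
    exact hsub
  refine ⟨fun y ↦ χ y • chartField ξ x₀ y, ?_, Metric.closedBall _ (r / 2),
    Metric.closedBall_mem_nhds _ (by positivity),
    (Metric.closedBall_subset_closedBall (by linarith)).trans hsub, fun y hy ↦ ?_⟩
  · rw [← contMDiff_iff_contDiff]
    refine contMDiff_of_tsupport fun y hy ↦ ContDiffAt.contMDiffAt ?_
    have hy' := hχ (tsupport_smul_subset_left _ _ hy)
    exact χ.contDiffAt.smul ((contDiffOn_chartField hξ x₀).contDiffAt (hopen.mem_nhds hy'))
  · simp only
    rw [χ.one_of_mem_closedBall hy, one_smul]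

variable [T2Space V]

theorem IsFlow.map_add (hξ : ContMDiff 𝓘(ℝ, E) 𝓘(ℝ, E).tangent ∞
      (fun x ↦ (⟨x, ξ x⟩ : TangentBundle 𝓘(ℝ, E) V))) (hφ : IsFlow ξ φ) (s t : ℝ) (x : V)
    [CompleteSpace E] : φ (s + t) x = φ s (φ t x) := by
  have : IsManifold 𝓘(ℝ, E) 1 V := IsManifold.of_le (n := ∞) (by simp)
  have h1 : IsMIntegralCurve (I := 𝓘(ℝ, E)) ((fun s ↦ φ s x) ∘ (· + t)) ξ :=
    (hφ.isMIntegralCurve x).comp_add t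
  have h2 := hφ.isMIntegralCurve (φ t x)
  have h3 := isMIntegralCurve_Ioo_eq_of_contMDiff_boundaryless (t₀ := 0) (hξ.of_le (by simp)) h1 h2
    (by simp [hφ.map_zero])
  exact congrFun h3 s

/-- Time `τ` along `ξ` is time `1` along `τ • ξ`; uniqueness of integral curves identifies `φ` near
time `0` with the smooth local flow in a chart. -/
theorem IsFlow.contMDiffAt_uncurry_zero [FiniteDimensional ℝ E]
    (hξ : ContMDiff 𝓘(ℝ, E) 𝓘(ℝ, E).tangent ∞
      (fun x ↦ (⟨x, ξ x⟩ : TangentBundle 𝓘(ℝ, E) V))) (hφ : IsFlow ξ φ) (x₀ : V) :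
    ContMDiffAt (𝓘(ℝ, ℝ).prod 𝓘(ℝ, E)) 𝓘(ℝ, E) ∞ (Function.uncurry φ) (0, x₀) := by
  have : IsManifold 𝓘(ℝ, E) 1 V := IsManifold.of_le (n := ∞) (by simp)
  have : CompleteSpace E := FiniteDimensional.complete ℝ E
  obtain ⟨f, hf, U, hU, hUt, hfU⟩ := exists_contDiff_eqOn_chartField hξ x₀
  obtain ⟨ψ, hψ, hev⟩ := exists_contDiffAt_localFlow hf _ hU
  set e := extChartAt 𝓘(ℝ, E) x₀ with he
  have hψt : ψ (0, e x₀) ∈ e.target := by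
    obtain ⟨γ, -, h1, h2⟩ := hev.self_of_nhds
    rw [← h1]
    exact hUt (h2 1 (by constructor <;> norm_num)).1
  have hj : ContMDiffAt (𝓘(ℝ, ℝ).prod 𝓘(ℝ, E)) 𝓘(ℝ, ℝ × E) ∞
      (fun q : ℝ × V ↦ (q.1, e q.2)) (0, x₀) := by
    refine contMDiffAt_fst.prodMk_space ?_
    exact (contMDiffAt_extChartAt (x := x₀)).comp ((0 : ℝ), x₀) contMDiffAt_snd
  have hsymm : ContMDiffAt 𝓘(ℝ, E) 𝓘(ℝ, E) ∞ e.symm (ψ (0, e x₀)) :=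
    (contMDiffOn_extChartAt_symm x₀).contMDiffAt
      ((isOpen_extChartAt_target (I := 𝓘(ℝ, E)) x₀).mem_nhds hψt)
  have hcomp : ContMDiffAt (𝓘(ℝ, ℝ).prod 𝓘(ℝ, E)) 𝓘(ℝ, E) ∞
      (fun q : ℝ × V ↦ e.symm (ψ (q.1, e q.2))) (0, x₀) :=
    ContMDiffAt.comp (g := e.symm) (0, x₀) hsymm
      (ContMDiffAt.comp (g := ψ) (0, x₀) hψ.contMDiffAt hj)
  refine hcomp.congr_of_eventuallyEq ?_
  have hsrc : ∀ᶠ q : ℝ × V in 𝓝 (0, x₀), q.2 ∈ e.source :=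
    continuous_snd.continuousAt.eventually (extChartAt_source_mem_nhds (I := 𝓘(ℝ, E)) x₀)
  have hjc : Tendsto (fun q : ℝ × V ↦ (q.1, e q.2)) (𝓝 (0, x₀)) (𝓝 (0, e x₀)) :=
    hj.continuousAt
  filter_upwards [hsrc, hjc.eventually hev] with q hq hγ
  obtain ⟨τ, x⟩ := q
  obtain ⟨γ, h0, h1, h2⟩ := hγ
  simp only at h0 h1 h2 hq
  have hc : IsMIntegralCurveOn (I := 𝓘(ℝ, E)) (fun t ↦ e.symm (γ t)) (τ • ξ) (Ioo (-2) 2) := by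
    intro t ht
    obtain ⟨hm, hd⟩ := h2 t ht
    refine (hasMFDerivAt_extChartAt_symm_comp (ξ := τ • ξ) (hUt hm) ?_).hasMFDerivWithinAt
    rw [hfU hm] at hd
    convert hd using 1
    exact map_smul _ _ _
  have hc' : IsMIntegralCurveOn (I := 𝓘(ℝ, E)) ((fun s ↦ φ s x) ∘ (· * τ)) (τ • ξ)
      (Ioo (-2) 2) := ((hφ.isMIntegralCurve x).comp_mul τ).isMIntegralCurveOn _
  have hτξ : ContMDiff 𝓘(ℝ, E) 𝓘(ℝ, E).tangent 1
      (fun x ↦ (⟨x, (τ • ξ) x⟩ : TangentBundle 𝓘(ℝ, E) V)) :=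
    (hξ.of_le (by simp)).const_smul_section
  have heq := isMIntegralCurveOn_Ioo_eqOn_of_contMDiff_boundaryless (t₀ := 0)
    (by constructor <;> norm_num) hτξ hc' hc (by simp [h0, hφ.map_zero, e.left_inv hq])
    (show (1 : ℝ) ∈ Ioo (-2 : ℝ) 2 by constructor <;> norm_num)
  simpa [h1] using heq

/-- Since `φ_s = φ_(s-s') ∘ φ_s'`, regularity at `x` passes between nearby times, so the set of good
times is clopen. The argument runs at finite order `m`, where regularity at a point is an open
condition. -/
theorem IsFlow.contMDiff_time [FiniteDimensional ℝ E]
    (hξ : ContMDiff 𝓘(ℝ, E) 𝓘(ℝ, E).tangent ∞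
      (fun x ↦ (⟨x, ξ x⟩ : TangentBundle 𝓘(ℝ, E) V))) (hφ : IsFlow ξ φ) (s : ℝ) :
    ContMDiff 𝓘(ℝ, E) 𝓘(ℝ, E) ∞ (φ s) := by
  have : CompleteSpace E := FiniteDimensional.complete ℝ E
  intro x
  rw [contMDiffAt_infty]
  intro m
  have : IsManifold 𝓘(ℝ, E) m V := IsManifold.of_le (n := ∞) (by exact_mod_cast le_top)
  set A : Set ℝ := {s | ContMDiffAt 𝓘(ℝ, E) 𝓘(ℝ, E) m (φ s) x} with hA
  have key : ∀ s₁, ∃ N ∈ 𝓝 s₁, ∀ s ∈ N, ∀ s' ∈ N, s' ∈ A → s ∈ A := by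
    intro s₁
    have h1 : ContMDiffAt (𝓘(ℝ, ℝ).prod 𝓘(ℝ, E)) 𝓘(ℝ, E) m (Function.uncurry φ) (0, φ s₁ x) :=
      contMDiffAt_infty.1 (hφ.contMDiffAt_uncurry_zero hξ _) m
    have h2 := (contMDiffAt_iff_contMDiffAt_nhds (by simp)).1 h1
    have h3 : ContinuousAt (fun p : ℝ × ℝ ↦ (p.1 - p.2, φ p.2 x)) (s₁, s₁) :=
      (continuous_fst.sub continuous_snd).continuousAt.prodMk
        ((hφ.isMIntegralCurve x).continuous.comp continuous_snd).continuousAt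
    have h4 := h3.eventually (by simpa using h2)
    rw [nhds_prod_eq] at h4
    obtain ⟨N, hN, hN'⟩ := (eventually_prod_self_iff (r := fun a b ↦
      ContMDiffAt (𝓘(ℝ, ℝ).prod 𝓘(ℝ, E)) 𝓘(ℝ, E) m (Function.uncurry φ) (a - b, φ b x))).1 h4
    refine ⟨N, hN, fun s hs s' hs' hs'A ↦ ?_⟩
    have h5 : φ s = Function.uncurry φ ∘ fun y ↦ (s - s', φ s' y) := by
      funext y
      simp [← hφ.map_add hξ]
    show ContMDiffAt _ _ _ _ _
    rw [h5]
    exact ContMDiffAt.comp x (hN' s hs s' hs') (contMDiffAt_const.prodMk hs'A)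
  have hclopen : IsClopen A := by
    constructor
    · refine isClosed_of_closure_subset fun s₁ hs₁ ↦ ?_
      obtain ⟨N, hN, h⟩ := key s₁
      obtain ⟨s', hs', hs'A⟩ := mem_closure_iff_nhds.1 hs₁ N hN
      exact h s₁ (mem_of_mem_nhds hN) s' hs' hs'A
    · rw [isOpen_iff_mem_nhds]
      intro s₁ hs₁
      obtain ⟨N, hN, h⟩ := key s₁
      exact mem_of_superset hN fun s hs ↦ h s hs s₁ (mem_of_mem_nhds hN) hs₁
  have h0 : (0 : ℝ) ∈ A := by
    have : φ 0 = id := funext hφ.map_zero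
    show ContMDiffAt _ _ _ _ _
    rw [this]
    exact contMDiffAt_id
  exact (hclopen.eq_univ ⟨0, h0⟩ ▸ mem_univ s : s ∈ A)

/-- The flow of a smooth complete vector field is smooth in time and position jointly. -/
theorem IsFlow.contMDiff_uncurry [FiniteDimensional ℝ E]
    (hξ : ContMDiff 𝓘(ℝ, E) 𝓘(ℝ, E).tangent ∞
      (fun x ↦ (⟨x, ξ x⟩ : TangentBundle 𝓘(ℝ, E) V))) (hφ : IsFlow ξ φ) :
    ContMDiff (𝓘(ℝ, ℝ).prod 𝓘(ℝ, E)) 𝓘(ℝ, E) ∞ (Function.uncurry φ) := by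
  have : CompleteSpace E := FiniteDimensional.complete ℝ E
  rintro ⟨s₀, x₀⟩
  have h1 : Function.uncurry φ = Function.uncurry φ ∘
      fun q : ℝ × V ↦ (q.1 - s₀, φ s₀ q.2) := by
    funext q
    simp [Function.uncurry, ← hφ.map_add hξ]
  rw [h1]
  refine ContMDiffAt.comp (I' := 𝓘(ℝ, ℝ).prod 𝓘(ℝ, E)) (s₀, x₀) ?_ ?_
  · simpa using hφ.contMDiffAt_uncurry_zero hξ (φ s₀ x₀)
  · refine ContMDiffAt.prodMk ?_ ?_
    · exact ContMDiffAt.comp (I' := 𝓘(ℝ, ℝ)) (g := fun s : ℝ ↦ s - s₀) (s₀, x₀)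
        (contDiff_id.sub contDiff_const).contMDiff.contMDiffAt contMDiffAt_fst
    · exact ContMDiffAt.comp (I' := 𝓘(ℝ, E)) (g := φ s₀) (s₀, x₀)
        (hφ.contMDiff_time hξ s₀).contMDiffAt contMDiffAt_snd

end Flow

/-! ### Linear algebra of Lorentzian forms and the S-lemma. -/

section LorentzForm

variable {E : Type*} [NormedAddCommGroup E] [NormedSpace ℝ E] {b D : E →L[ℝ] E →L[ℝ] ℝ}

/-- A symmetric bilinear form of signature `(+,-,…,-)`. -/
structure IsLorentzForm (b : E →L[ℝ] E →L[ℝ] ℝ) : Prop where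
  symm : ∀ u v, b u v = b v u
  exists_timelike : ∃ u, 0 < b u u ∧ ∀ v, b u v = 0 → v ≠ 0 → b v v < 0

theorem IsLorentzForm.neg_of_orthogonal (hb : IsLorentzForm b) {t v : E} (ht : 0 < b t t)
    (htv : b t v = 0) (hv : v ≠ 0) : b v v < 0 := by
  obtain ⟨u, hu, hneg⟩ := hb.exists_timelike
  have hα : b u t ≠ 0 := fun h ↦ by
    have ht0 : t ≠ 0 := fun h0 ↦ by simp [h0] at ht
    exact lt_asymm ht (hneg t h ht0)
  by_contra! hvv
  -- The combination of `t` and `v` orthogonal to `u`: it would be causal if `v` were not spacelike,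
  -- hence zero.
  set z := b u v • t - b u t • v with hz
  have huz : b u z = 0 := by simp [hz]; ring
  have hzz : 0 ≤ b z z := by
    have hvt : b v t = 0 := by rw [hb.symm, htv]
    have : b z z = (b u v) ^ 2 * b t t + (b u t) ^ 2 * b v v := by
      simp [hz, htv, hvt]; ring
    rw [this]
    positivity
  have hz0 : z = 0 := by
    by_contra h
    exact absurd (hneg z huz h) (not_lt.2 hzz)
  have h1 : b t z = 0 := by rw [hz0, map_zero]
  have h2 : b u v = 0 := by
    simp only [hz, map_sub, map_smul, htv, smul_eq_mul, mul_zero, sub_zero, mul_eq_zero] at h1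
    exact h1.resolve_right ht.ne'
  rw [hz, h2, zero_smul, zero_sub, neg_eq_zero, smul_eq_zero] at hz0
  exact hz0.elim hα hv

theorem IsLorentzForm.ne_zero_of_causal (hb : IsLorentzForm b) {t v : E} (ht : 0 < b t t)
    (hv : 0 ≤ b v v) (hv0 : v ≠ 0) : b t v ≠ 0 :=
  fun h ↦ absurd (hb.neg_of_orthogonal ht h hv0) (not_lt.2 hv)

theorem IsLorentzForm.nonpos_of_orthogonal_null (hb : IsLorentzForm b) {k v : E} (hk0 : k ≠ 0)
    (hk : b k k = 0) (hkv : b k v = 0) : b v v ≤ 0 := by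
  by_contra! h
  exact hb.ne_zero_of_causal h hk.ge hk0 (by rw [hb.symm, hkv])

theorem IsLorentzForm.exists_spacelike (hb : IsLorentzForm b) {k : E} (hk0 : k ≠ 0)
    (hk : b k k = 0) : ∃ w, b w w < 0 := by
  obtain ⟨t, ht, hneg⟩ := hb.exists_timelike
  refine ⟨b t t • k - b t k • t, hneg _ (by simp; ring) fun h ↦ ?_⟩
  have h1 := hb.ne_zero_of_causal ht hk.ge hk0
  have h2 : b k (b t t • k - b t k • t) = 0 := by rw [h, map_zero]
  rw [map_sub, map_smul, map_smul, hk, hb.symm k t] at h2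
  simp [h1] at h2

/-- If `b k l` were zero, the plane of `k` and `l` would be totally null, yet it contains a nonzero
vector orthogonal to a timelike one. So `c = b k l` works. -/
theorem IsLorentzForm.exists_timelike_add_smul (hb : IsLorentzForm b) {k l : E}
    (hkl : LinearIndependent ℝ ![k, l]) (hk : b k k = 0) (hl : b l l = 0) :
    ∃ c : ℝ, 0 < b (k + c • l) (k + c • l) := by
  obtain ⟨t, ht, hneg⟩ := hb.exists_timelike
  have hl0 : l ≠ 0 := by simpa using hkl.ne_zero 1
  have hc : b k l ≠ 0 := by
    intro h
    have hlk : b l k = 0 := by rw [hb.symm, h]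
    have hz : b t l • k - b t k • l = 0 := by
      by_contra hz
      have := hneg _ (by simp; ring) hz
      simp [hk, hl, h, hlk] at this
    have := LinearIndependent.pair_iff.1 hkl (b t l) (-b t k)
      (by rw [neg_smul, ← sub_eq_add_neg, hz])
    exact hb.ne_zero_of_causal ht hl.ge hl0 this.1
  refine ⟨b k l, ?_⟩
  have : b (k + b k l • l) (k + b k l • l) = 2 * (b k l) ^ 2 := by
    simp [hk, hl, hb.symm l k]; ring
  rw [this]
  positivity

/-- If a symmetric form is nonnegative on the null cone, its quotient by the Lorentzian form is
larger on timelike than on spacelike vectors. -/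
theorem add_nonneg_of_nonneg_on_null (hb : ∀ u v, b u v = b v u) (hD : ∀ u v, D u v = D v u)
    (hnull : ∀ k, b k k = 0 → 0 ≤ D k k) {t w : E} (ht : 0 < b t t) (hw : b w w < 0) :
    0 ≤ D t t * (-b w w) + D w w * b t t := by
  set A := -b w w with hA
  set B := b t w with hB
  set C := b t t with hC
  have hA0 : 0 < A := by linarith
  set R := √(B ^ 2 + A * C) with hR
  have hAC : 0 < A * C := by positivity
  have hR2 : R ^ 2 = B ^ 2 + A * C := Real.sq_sqrt (by positivity)
  have hRB : |B| < R := by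
    rw [hR, ← Real.sqrt_sq_eq_abs]
    exact Real.sqrt_lt_sqrt (sq_nonneg _) (by linarith)
  obtain ⟨h1, h2⟩ := abs_lt.1 hRB
  have hw' : b w w = -A := by rw [hA, neg_neg]
  -- For `r = ±R` the vectors `A t + (B + r) w` span the two null lines of the plane of `t` and `w`.
  have hroot : ∀ r : ℝ, r ^ 2 = B ^ 2 + A * C →
      0 ≤ A ^ 2 * D t t + 2 * (A * (B + r)) * D t w + (B + r) ^ 2 * D w w := by
    intro r hr
    have h := hnull (A • t + (B + r) • w) (by
      simp only [map_add, map_smul, add_apply, smul_apply,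
        smul_eq_mul, hb w t, ← hB, ← hC, hw']
      linear_combination -A * hr)
    simp only [map_add, map_smul, add_apply, smul_apply,
        smul_eq_mul, hD w t] at h
    linarith
  have hp := hroot R hR2
  have hm := hroot (-R) (by rw [neg_sq, hR2])
  -- The positive weights `R - B` and `R + B` cancel the cross term `D t w`.
  have hsum : 0 ≤ 2 * R * A * (A * D t t + C * D w w) := by
    have e1 := mul_nonneg (show (0 : ℝ) ≤ R - B by linarith) hp
    have e2 := mul_nonneg (show (0 : ℝ) ≤ R + B by linarith) hm
    have : 2 * R * A * (A * D t t + C * D w w) =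
      (R - B) * (A ^ 2 * D t t + 2 * (A * (B + R)) * D t w + (B + R) ^ 2 * D w w) +
      (R + B) * (A ^ 2 * D t t + 2 * (A * (B + -R)) * D t w + (B + -R) ^ 2 * D w w) := by
      linear_combination (-2 * R * D w w) * hR2
    rw [this]
    exact add_nonneg e1 e2
  have hR0 : 0 < R := (abs_nonneg B).trans_lt hRB
  have := nonneg_of_mul_nonneg_right hsum (by positivity)
  linarith

/-- The S-lemma for Lorentzian forms. -/
theorem IsLorentzForm.exists_mul_le (hb : IsLorentzForm b) (hD : ∀ u v, D u v = D v u)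
    (hnull : ∀ k, b k k = 0 → 0 ≤ D k k) (hw : ∃ w, b w w < 0) :
    ∃ a : ℝ, ∀ v, a * b v v ≤ D v v := by
  obtain ⟨w₀, hw₀⟩ := hw
  obtain ⟨t₀, ht₀, -⟩ := hb.exists_timelike
  set S : Set ℝ := {r | ∃ t, 0 < b t t ∧ D t t / b t t = r} with hS
  have hlow : ∀ w, b w w < 0 → D w w / b w w ∈ lowerBounds S := by
    rintro w hw _ ⟨t, ht, rfl⟩
    have h := add_nonneg_of_nonneg_on_null hb.symm hD hnull ht hw
    rw [← neg_div_neg_eq, div_le_div_iff₀ (neg_pos.2 hw) ht]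
    linarith
  -- The infimum of `D/b` over timelike vectors lies above every quotient on a spacelike vector;
  -- this separates the two families.
  refine ⟨sInf S, fun v ↦ ?_⟩
  rcases lt_trichotomy (b v v) 0 with hv | hv | hv
  · have h := le_csInf (⟨_, t₀, ht₀, rfl⟩ : S.Nonempty) (hlow v hv)
    rwa [div_le_iff_of_neg hv] at h
  · rw [hv, mul_zero]
    exact hnull v hv
  · have h := csInf_le ⟨_, hlow w₀ hw₀⟩ (show D v v / b v v ∈ S from ⟨v, hv, rfl⟩)
    rwa [le_div_iff₀ hv] at h

/-- A vector in the common null set of `b` and a form bounded below by `a b` is an eigenvector. -/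
theorem eq_mul_of_null {a : ℝ} (hb : ∀ u v, b u v = b v u) (hD : ∀ u v, D u v = D v u)
    (ha : ∀ v, a * b v v ≤ D v v) {k : E} (hk : b k k = 0) (hDk : D k k = 0) (v : E) :
    D k v = a * b k v := by
  -- `D - a b` is nonnegative along `k + r v` and has no constant term there, so its linear
  -- coefficient vanishes.
  have h : ∀ r : ℝ, 0 ≤ (D v v - a * b v v) * (r * r) + 2 * (D k v - a * b k v) * r + 0 := by
    intro r
    have := ha (k + r • v)
    simp only [map_add, map_smul, add_apply, smul_apply, smul_eq_mul, hD v k, hb v k, hk, hDk]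
      at this
    linarith
  have hd := discrim_le_zero h
  rw [discrim] at hd
  have : (D k v - a * b k v) ^ 2 ≤ 0 := by linarith
  have h0 := pow_eq_zero_iff (two_ne_zero) |>.1 (le_antisymm this (sq_nonneg _))
  linarith

end LorentzForm

/-! ### Kernels of decomposable forms and their transport. -/

section Wedge

variable {E : Type*} [NormedAddCommGroup E] [NormedSpace ℝ E] {b : E →L[ℝ] E →L[ℝ] ℝ}

theorem IsLorentzForm.eq_zero_of_forall (hb : IsLorentzForm b) {v : E} (h : ∀ w, b v w = 0) :
    v = 0 := by
  obtain ⟨t, ht, -⟩ := hb.exists_timelike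
  by_contra hv
  exact (hb.neg_of_orthogonal ht (by rw [hb.symm, h]) hv).ne (h v)

/-- A functional vanishing on the range of `v ↦ (b (k i) v)` gives a linear relation among the `k
i`, because `b` is nondegenerate. -/
theorem IsLorentzForm.exists_apply_eq (hb : IsLorentzForm b) {p : ℕ} {k : Fin p → E}
    (hk : LinearIndependent ℝ k) (y : Fin p → ℝ) : ∃ v, ∀ i, b (k i) v = y i := by
  let L : E →ₗ[ℝ] Fin p → ℝ := LinearMap.pi fun i ↦ (b (k i)).toLinearMap
  suffices h : LinearMap.range L = ⊤ by
    obtain ⟨v, hv⟩ := LinearMap.range_eq_top.1 h y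
    exact ⟨v, fun i ↦ congrFun hv i⟩
  by_contra hne
  obtain ⟨f, hf0, hf⟩ := Submodule.exists_le_ker_of_lt_top _ (lt_top_iff_ne_top.2 hne)
  have hsum : ∑ i, f (Pi.single i 1) • k i = 0 := by
    refine hb.eq_zero_of_forall fun v ↦ ?_
    have h1 : f (L v) = 0 := hf ⟨v, rfl⟩
    rw [LinearMap.pi_apply_eq_sum_univ] at h1
    simp only [map_sum, map_smul, sum_apply, smul_apply, smul_eq_mul]
    rw [← h1]
    refine Finset.sum_congr rfl fun i _ ↦ ?_
    rw [smul_eq_mul, mul_comm]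
    congr 1
    congr 1
    ext j
    simp [Pi.single_apply, eq_comm]
  have hzero := Fintype.linearIndependent_iff.1 hk _ hsum
  refine hf0 (LinearMap.pi_ext' fun i ↦ LinearMap.ext_ring ?_)
  simpa using hzero i

/-- The kernel of `k₁♭ ∧ ⋯ ∧ k_p♭` is the orthogonal complement of the `kᵢ`. -/
theorem IsLorentzForm.forall_det_update_eq_zero_iff (hb : IsLorentzForm b) {p : ℕ} {k : Fin p → E}
    (hk : LinearIndependent ℝ k) (v : E) :
    (∀ (w : Fin p → E) (i : Fin p),
      (Matrix.of fun l j ↦ b (k l) (Function.update w i v j)).det = 0) ↔ ∀ i, b (k i) v = 0 := by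
  constructor
  · intro h i
    -- With vectors `e j` dual to the `k l`, replacing `e i` by `v` leaves a determinant equal to `b
    -- (k i) v`.
    choose e he using fun j ↦ hb.exists_apply_eq hk (fun l ↦ (1 : Matrix (Fin p) (Fin p) ℝ) l j)
    have h1 := h e i
    have h2 : (Matrix.of fun l j ↦ b (k l) (Function.update e i v j)) =
        (1 : Matrix (Fin p) (Fin p) ℝ).updateCol i fun l ↦ b (k l) v := by
      ext l j
      rcases eq_or_ne j i with rfl | hj
      · simp
      · simp [hj, he]
    rwa [h2, ← Matrix.cramer_apply, Matrix.cramer_one] at h1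
  · intro h w i
    refine Matrix.det_eq_zero_of_column_eq_zero i fun l ↦ ?_
    simp [h]

theorem IsLorentzForm.exists_det_ne_zero (hb : IsLorentzForm b) {p : ℕ} {k : Fin p → E}
    (hk : LinearIndependent ℝ k) :
    ∃ w : Fin p → E, (Matrix.of fun l j ↦ b (k l) (w j)).det ≠ 0 := by
  choose e he using fun j ↦ hb.exists_apply_eq hk (fun l ↦ (1 : Matrix (Fin p) (Fin p) ℝ) l j)
  refine ⟨e, ?_⟩
  have : (Matrix.of fun l j ↦ b (k l) (e j)) = 1 := by
    ext l j
    simp [he]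
  rw [this, Matrix.det_one]
  exact one_ne_zero

/-- A nowhere vanishing curve whose derivative is proportional to it keeps its zero components. -/
theorem eq_zero_of_deriv_eq_mul {ι : Type*} {c : ℝ → ι → ℝ} {β : ℝ → ℝ}
    (hd : ∀ s v, HasDerivAt (fun s ↦ c s v) (β s * c s v) s) (hne : ∀ s, ∃ v, c s v ≠ 0) {v : ι}
    {r : ℝ} (hr : c r v = 0) (s : ℝ) : c s v = 0 := by
  have hcont : ∀ v, Continuous fun s ↦ c s v := fun v ↦
    continuous_iff_continuousAt.2 fun s ↦ (hd s v).continuousAt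
  have hclopen : IsClopen {s | c s v = 0} := by
    refine ⟨isClosed_eq (hcont v) continuous_const, Metric.isOpen_iff.2 fun s₀ hs₀ ↦ ?_⟩
    obtain ⟨w, hw⟩ := hne s₀
    obtain ⟨δ, hδ, hball⟩ := Metric.eventually_nhds_iff_ball.1
      ((hcont w).continuousAt.eventually_ne hw)
    refine ⟨δ, hδ, fun s hs ↦ ?_⟩
    -- The quotient of two components is locally constant. This avoids integrating `β`, about which
    -- no regularity is assumed.
    have hq : ∀ x ∈ Metric.ball s₀ δ, HasDerivAt (fun s ↦ c s v / c s w) 0 x := fun x hx ↦ by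
      refine ((hd x v).div (hd x w) (hball x hx)).congr_deriv ?_
      rw [div_eq_zero_iff]
      left
      ring
    have hconst := (convex_ball s₀ δ).is_const_of_fderivWithin_eq_zero (𝕜 := ℝ)
      (f := fun s ↦ c s v / c s w)
      (fun x hx ↦ (hq x hx).differentiableAt.differentiableWithinAt)
      (fun x hx ↦ by
        rw [fderivWithin_of_isOpen Metric.isOpen_ball hx, (hq x hx).hasFDerivAt.fderiv]
        simp) hs (Metric.mem_ball_self hδ)
    have hs₀' : c s₀ v = 0 := hs₀
    simp only [hs₀', zero_div, div_eq_zero_iff, hball s hs, or_false] at hconst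
    exact hconst
  exact (hclopen.eq_univ ⟨r, hr⟩ ▸ mem_univ s : s ∈ {s | c s v = 0})

end Wedge

/-! ### A one-sided differential inequality. -/

section Comparison

/-- A function that satisfies `M f ≤ f'` locally where it is negative stays nonnegative. -/
theorem nonneg_of_mul_le_deriv {f f' : ℝ → ℝ} (hf : ∀ s, HasDerivAt f (f' s) s) (h0 : 0 ≤ f 0)
    (hloc : ∀ s₀, 0 ≤ s₀ → ∃ M : ℝ, ∀ᶠ s in 𝓝[>] s₀, f s < 0 → M * f s ≤ f' s) {s : ℝ}
    (hs : 0 ≤ s) : 0 ≤ f s := by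
  have hcont : Continuous f := continuous_iff_continuousAt.2 fun s ↦ (hf s).continuousAt
  refine IsClosed.Icc_subset_of_forall_exists_gt (a := 0) (b := s) (s := {s | 0 ≤ f s})
    ((isClosed_le continuous_const hcont).inter isClosed_Icc) h0 ?_ (right_mem_Icc.2 hs)
  rintro x ⟨hx, hx0, -⟩ y (hxy : x < y)
  by_contra hne
  have hneg : ∀ z ∈ Ioc x y, f z < 0 := fun z hz ↦ by
    by_contra! h
    exact hne ⟨z, h, hz⟩
  obtain ⟨M, hM⟩ := hloc x hx0
  obtain ⟨u, hu, hsub⟩ := mem_nhdsGT_iff_exists_Ioo_subset.1 hM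
  set z := min y u with hz
  have hxz : x < z := lt_min hxy hu
  -- If `f` were negative just after `x`, then `exp(-M r) f r` would increase from a nonnegative
  -- value to a negative one.
  have hmono : MonotoneOn (fun r ↦ Real.exp (-M * r) * f r) (Icc x z) := by
    have hd : ∀ r, HasDerivAt (fun r ↦ Real.exp (-M * r) * f r)
        (Real.exp (-M * r) * (f' r - M * f r)) r := by
      intro r
      have h1 : HasDerivAt (fun r ↦ Real.exp (-M * r)) (Real.exp (-M * r) * -M) r := by
        simpa using ((hasDerivAt_id r).const_mul (-M)).exp
      exact (h1.mul (hf r)).congr_deriv (by ring)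
    refine monotoneOn_of_deriv_nonneg (convex_Icc x z)
      (continuous_iff_continuousAt.2 fun r ↦ (hd r).continuousAt).continuousOn
      (fun r _ ↦ (hd r).differentiableAt.differentiableWithinAt) fun r hr ↦ ?_
    rw [interior_Icc] at hr
    rw [(hd r).deriv]
    have hr1 : f r < 0 := hneg r ⟨hr.1, (hr.2.trans_le (min_le_left _ _)).le⟩
    exact mul_nonneg (Real.exp_pos _).le
      (sub_nonneg.2 (hsub ⟨hr.1, hr.2.trans_le (min_le_right _ _)⟩ hr1))
  have h1 := hmono (left_mem_Icc.2 hxz.le) (right_mem_Icc.2 hxz.le) hxz.le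
  have h2 : Real.exp (-M * z) * f z < 0 :=
    mul_neg_of_pos_of_neg (Real.exp_pos _) (hneg z ⟨hxz, min_le_left _ _⟩)
  have h3 : 0 ≤ Real.exp (-M * x) * f x := mul_nonneg (Real.exp_pos _).le hx
  simp only at h1
  linarith

end Comparison

/-! ### Expanding curves of Lorentzian forms. -/

section Curve

set_option synthInstance.maxHeartbeats 200000

variable {E : Type*} [NormedAddCommGroup E] [NormedSpace ℝ E] {B : ℝ → E →L[ℝ] E →L[ℝ] ℝ}

theorem hasDerivAt_bilin_apply {B' : E →L[ℝ] E →L[ℝ] ℝ} {s : ℝ} (h : HasDerivAt B B' s) (u v : E) :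
    HasDerivAt (fun s ↦ B s u v) (B' u v) s := by
  have h1 := h.clm_apply (hasDerivAt_const s u)
  have h2 := h1.clm_apply (hasDerivAt_const s v)
  simpa using h2

/-- A `C¹` curve of Lorentzian forms whose derivative is nonnegative on the null vectors. -/
structure IsExpandingCurve (B : ℝ → E →L[ℝ] E →L[ℝ] ℝ) : Prop where
  contDiff : ContDiff ℝ 1 B
  lorentz : ∀ s, IsLorentzForm (B s)
  nonneg : ∀ s k, B s k k = 0 → 0 ≤ deriv B s k k

namespace IsExpandingCurve

theorem hasDerivAt (hB : IsExpandingCurve B) (s : ℝ) : HasDerivAt B (deriv B s) s :=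
  (hB.contDiff.differentiable (by simp) s).hasDerivAt

theorem hasDerivAt_apply (hB : IsExpandingCurve B) (u v : E) (s : ℝ) :
    HasDerivAt (fun s ↦ B s u v) (deriv B s u v) s :=
  hasDerivAt_bilin_apply (hB.hasDerivAt s) u v

theorem continuous_deriv (hB : IsExpandingCurve B) : Continuous (deriv B) :=
  hB.contDiff.continuous_deriv (by simp)

theorem deriv_symm (hB : IsExpandingCurve B) (s : ℝ) (u v : E) :
    deriv B s u v = deriv B s v u :=
  (hB.hasDerivAt_apply u v s).unique
    ((hB.hasDerivAt_apply v u s).congr_of_eventuallyEq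
      (Eventually.of_forall fun r ↦ (hB.lorentz r).symm u v))

theorem exists_timelike_bound (hB : IsExpandingCurve B) (s₀ : ℝ) :
    ∃ M : ℝ, ∃ t : E, ∀ᶠ s in 𝓝 s₀, 0 < B s t t ∧ deriv B s t t ≤ M * B s t t := by
  obtain ⟨t, ht, -⟩ := (hB.lorentz s₀).exists_timelike
  have hc : Continuous fun s ↦ B s t t :=
    (hB.contDiff.continuous.clm_apply continuous_const).clm_apply continuous_const
  have hc' : Continuous fun s ↦ deriv B s t t :=
    (hB.continuous_deriv.clm_apply continuous_const).clm_apply continuous_const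
  refine ⟨deriv B s₀ t t / B s₀ t t + 1, t, ?_⟩
  have h1 : ∀ᶠ s in 𝓝 s₀, 0 < B s t t := hc.continuousAt.eventually (lt_mem_nhds ht)
  have h2 : ContinuousAt (fun s ↦ deriv B s t t / B s t t) s₀ :=
    hc'.continuousAt.div hc.continuousAt ht.ne'
  have h3 := h2.eventually (gt_mem_nhds (lt_add_one (deriv B s₀ t t / B s₀ t t)))
  filter_upwards [h1, h3] with s hs hs'
  exact ⟨hs, ((div_lt_iff₀ hs).1 hs').le⟩

/-- One timelike vector `t` controls all spacelike ones: `B'(t,t) ≤ M B(t,t)` forces `B'(v,v) ≥ M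
B(v,v)` wherever `B(v,v) < 0`. -/
theorem nonneg_of_nonneg (hB : IsExpandingCurve B) {v : E} (hv : 0 ≤ B 0 v v) {s : ℝ}
    (hs : 0 ≤ s) : 0 ≤ B s v v := by
  refine nonneg_of_mul_le_deriv (hB.hasDerivAt_apply v v) hv (fun s₀ _ ↦ ?_) hs
  obtain ⟨M, t, h⟩ := hB.exists_timelike_bound s₀
  refine ⟨M, ?_⟩
  filter_upwards [nhdsWithin_le_nhds h] with r ⟨h1, h2⟩ hneg
  have h3 := add_nonneg_of_nonneg_on_null (hB.lorentz r).symm (hB.deriv_symm r) (hB.nonneg r) h1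
    hneg
  have h4 : deriv B r t t * (-B r v v) ≤ M * B r t t * (-B r v v) :=
    mul_le_mul_of_nonneg_right h2 (by linarith)
  have h5 : 0 ≤ B r t t * (deriv B r v v - M * B r v v) := by linarith
  linarith [nonneg_of_mul_nonneg_right h5 h1]

/-- If the orthogonal complement of subspaces `W s`, on which `B' = a B`, does not depend on `s`,
and the `W s` contain timelike vectors, then null vectors of `W 0` stay null. -/
theorem null_of_timelike [FiniteDimensional ℝ E] (hB : IsExpandingCurve B)
    {W : ℝ → Submodule ℝ E} {N : Submodule ℝ E}
    (hN : ∀ s v, v ∈ N ↔ ∀ w ∈ W s, B s w v = 0) (htime : ∀ s, ∃ t ∈ W s, 0 < B s t t)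
    {a : ℝ → ℝ} (ha : ∀ s v, a s * B s v v ≤ deriv B s v v)
    (hW : ∀ s, ∀ w ∈ W s, ∀ v, deriv B s w v = a s * B s w v)
    {k : E} (hk : k ∈ W 0) (hk0 : B 0 k k = 0) {s : ℝ} (hs : 0 ≤ s) : B s k k = 0 := by
  have hneg : ∀ s, ∀ n ∈ N, n ≠ 0 → B s n n < 0 := by
    intro s n hn hn0
    obtain ⟨t, ht, ht0⟩ := htime s
    exact (hB.lorentz s).neg_of_orthogonal ht0 ((hN s n).1 hn t ht) hn0
  -- `B s` is nondegenerate on `W s`, which contains a timelike vector, so `E` is the sum of `W s`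
  -- and its orthogonal complement `N`.
  have hdecomp : ∀ s v, ∃ w ∈ W s, ∃ n ∈ N, v = w + n := by
    intro s v
    let β : LinearMap.BilinForm ℝ E :=
      LinearMap.mk₂ ℝ (fun u v ↦ B s u v) (by simp) (by simp) (by simp) (by simp)
    have hβ : β.IsRefl := fun u v h ↦ by
      change B s v u = 0
      rw [(hB.lorentz s).symm]
      exact h
    have hnd : (β.restrict (W s)).Nondegenerate := by
      have hsep : ∀ w : W s, (∀ w' : W s, B s w w' = 0) → w = 0 := by
        intro w hw
        obtain ⟨t, ht, ht0⟩ := htime s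
        by_contra hne
        have := (hB.lorentz s).neg_of_orthogonal ht0
          (by rw [(hB.lorentz s).symm]; exact hw ⟨t, ht⟩) (fun h ↦ hne (Subtype.ext h))
        exact this.ne (hw w)
      refine ⟨fun w hw ↦ hsep w hw, fun w hw ↦ hsep w fun w' ↦ ?_⟩
      rw [(hB.lorentz s).symm]
      exact hw w'
    have hcompl := LinearMap.BilinForm.isCompl_orthogonal_of_restrict_nondegenerate hβ hnd
    have hv : v ∈ W s ⊔ β.orthogonal (W s) := by
      rw [hcompl.sup_eq_top]
      exact Submodule.mem_top
    obtain ⟨w, hw, n, hn, rfl⟩ := Submodule.mem_sup.1 hv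
    exact ⟨w, hw, n, (hN s n).2 fun w hw ↦ hn w hw, rfl⟩
  have hperp : ∀ s, 0 ≤ s → (B s k).comp N.subtypeL = 0 := by
    intro s hs
    have hcont : Continuous fun p : ℝ × E ↦ -B p.1 p.2 p.2 :=
      (((hB.contDiff.continuous.comp continuous_fst).clm_apply continuous_snd).clm_apply
        continuous_snd).neg
    have hNc : IsClosed (N : Set E) := N.closed_of_finiteDimensional
    -- Compactness makes the negative definiteness of `B r` on the fixed space `N` uniform for `r ∈
    -- [0, s]`.
    obtain ⟨c, hc, hcb⟩ := (isCompact_Icc.prod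
      ((isCompact_sphere (0 : E) 1).inter_right hNc)).exists_forall_le'
      (hcont.continuousOn) (a := 0) (by
        rintro ⟨r, n⟩ ⟨-, hn, hnN⟩
        have hn0 : n ≠ 0 := fun h ↦ by simp [h] at hn
        exact neg_pos.2 (hneg r n hnN hn0)) (s := Icc 0 s ×ˢ (Metric.sphere (0 : E) 1 ∩ N))
    have hcoer : ∀ r ∈ Icc 0 s, ∀ n ∈ N, c * ‖n‖ ^ 2 ≤ -B r n n := by
      intro r hr n hn
      rcases eq_or_ne n 0 with rfl | hn0
      · simp
      · have hnn : 0 < ‖n‖ := norm_pos_iff.2 hn0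
        have h1 := hcb (r, ‖n‖⁻¹ • n) ⟨hr, by simp [norm_smul, hnn.ne'], N.smul_mem _ hn⟩
        simp only [map_smul, smul_apply, smul_eq_mul] at h1
        have h2 := mul_le_mul_of_nonneg_right h1 (sq_nonneg ‖n‖)
        refine h2.trans_eq ?_
        field_simp
    obtain ⟨C, hC⟩ := isCompact_Icc.exists_bound_of_continuousOn (f := deriv B) (s := Icc 0 s)
      hB.continuous_deriv.continuousOn
    have hH : ∀ r, HasDerivAt (fun r ↦ (B r k).comp N.subtypeL)
        ((deriv B r k).comp N.subtypeL) r := by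
      intro r
      have h1 : HasDerivAt (fun r ↦ B r k) (deriv B r k) r := by
        simpa using (hB.hasDerivAt r).clm_apply (hasDerivAt_const r k)
      simpa using h1.clm_comp (hasDerivAt_const r N.subtypeL)
    refine eq_zero_of_abs_deriv_le_mul_abs_self_of_eq_zero_right (K := C / c)
      (f' := fun r ↦ (deriv B r k).comp N.subtypeL)
      (continuous_iff_continuousAt.2 fun r ↦ (hH r).continuousAt).continuousOn
      (fun r _ ↦ (hH r).hasDerivWithinAt) ?_ ?_ s (right_mem_Icc.2 hs)
    · ext n
      exact (hN 0 n).1 n.2 k hk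
    · intro r hr
      have hr' : r ∈ Icc 0 s := ⟨hr.1, hr.2.le⟩
      have hC0 : 0 ≤ C := (norm_nonneg _).trans (hC r hr')
      obtain ⟨w, hw, m, hm, hkwm⟩ := hdecomp r k
      have hBk : ∀ n ∈ N, B r k n = B r m n := fun n hn ↦ by
        rw [hkwm, map_add, add_apply, (hN r n).1 hn w hw, zero_add]
      -- On `N` the `W r`-component drops out of `B'` as well as of `B`, so the possibly unbounded
      -- factor `a r` never enters the Grönwall constant.
      have hDk : ∀ n ∈ N, deriv B r k n = deriv B r m n := fun n hn ↦ by
        rw [hkwm, map_add, add_apply, hW r w hw, (hN r n).1 hn w hw, mul_zero,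
          zero_add]
      have hm1 : c * ‖m‖ ≤ ‖(B r k).comp N.subtypeL‖ := by
        rcases eq_or_ne m 0 with hm0 | hm0
        · rw [hm0, norm_zero, mul_zero]
          positivity
        · have hmm : 0 < ‖m‖ := norm_pos_iff.2 hm0
          have h1 := hcoer r hr' m hm
          have h2 := ((B r k).comp N.subtypeL).le_opNorm ⟨m, hm⟩
          have h3 : ((B r k).comp N.subtypeL) ⟨m, hm⟩ = B r m m := hBk m hm
          rw [h3, Real.norm_eq_abs] at h2
          have h4 : c * ‖m‖ * ‖m‖ ≤ ‖(B r k).comp N.subtypeL‖ * ‖m‖ := by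
            calc c * ‖m‖ * ‖m‖ = c * ‖m‖ ^ 2 := by ring
              _ ≤ -B r m m := h1
              _ ≤ |B r m m| := neg_le_abs _
              _ ≤ _ := h2
          exact le_of_mul_le_mul_right h4 hmm
      refine ContinuousLinearMap.opNorm_le_bound _ (by positivity) fun n ↦ ?_
      calc ‖((deriv B r k).comp N.subtypeL) n‖ = ‖deriv B r m n‖ := by
            rw [← hDk n n.2]; rfl
        _ ≤ ‖deriv B r‖ * ‖m‖ * ‖(n : E)‖ := (deriv B r).le_opNorm₂ m n
        _ ≤ C * (‖(B r k).comp N.subtypeL‖ / c) * ‖n‖ := by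
            gcongr
            · exact hC r hr'
            · rw [le_div_iff₀ hc]
              linarith
            · exact le_rfl
        _ = C / c * ‖(B r k).comp N.subtypeL‖ * ‖n‖ := by ring
  have hmem : ∀ r, (B r k).comp N.subtypeL = 0 → k ∈ W r := by
    intro r hr
    obtain ⟨w, hw, m, hm, hkwm⟩ := hdecomp r k
    have h1 : B r k m = 0 := DFunLike.congr_fun hr ⟨m, hm⟩
    rw [hkwm, map_add, add_apply, (hN r m).1 hm w hw, zero_add] at h1
    have hm0 : m = 0 := by
      by_contra h
      exact (hneg r m hm h).ne h1
    rw [hkwm, hm0, add_zero]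
    exact hw
  refine le_antisymm ?_ (hB.nonneg_of_nonneg hk0.ge hs)
  refine neg_nonneg.1 (nonneg_of_mul_le_deriv (f := fun s ↦ -B s k k)
    (fun s ↦ (hB.hasDerivAt_apply k k s).neg) (by rw [hk0, neg_zero]) (fun s₀ hs₀ ↦ ?_) hs)
  obtain ⟨M, t, h⟩ := hB.exists_timelike_bound s₀
  refine ⟨M, ?_⟩
  filter_upwards [nhdsWithin_le_nhds h, self_mem_nhdsWithin] with r ⟨h1, h2⟩ hr hneg'
  -- Only an upper bound on `a` is needed here, and the timelike vector `t` supplies it.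
  have haM : a r ≤ M := le_of_mul_le_mul_right ((ha r t).trans h2) h1
  rw [hW r k (hmem r (hperp r (hs₀.trans (le_of_lt hr)))) k]
  have := mul_le_mul_of_nonneg_right haM (neg_lt_zero.1 hneg').le
  linarith

/-- Null vectors in the span of the common null vectors `k s` of `B` and `B'` stay null, provided
that the orthogonal complement of the `k s` does not depend on `s`. -/
theorem null_of_mem_span [FiniteDimensional ℝ E] (hB : IsExpandingCurve B) {p : ℕ}
    {k : ℝ → Fin p → E} (hli : ∀ s, LinearIndependent ℝ (k s))
    (hnull : ∀ s i, B s (k s i) (k s i) = 0) (hD : ∀ s i, deriv B s (k s i) (k s i) = 0)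
    (hperp : ∀ s v, (∀ i, B s (k s i) v = 0) ↔ ∀ i, B 0 (k 0 i) v = 0)
    {v : E} (hv : v ∈ Submodule.span ℝ (range (k 0))) (hv0 : v ≠ 0) (hvn : B 0 v v = 0) {s : ℝ}
    (hs : 0 ≤ s) : B s v v = 0 := by
  match p with
  | 0 =>
    rw [range_eq_empty, Submodule.span_empty, Submodule.mem_bot] at hv
    exact absurd hv hv0
  | 1 =>
    refine le_antisymm ?_ (hB.nonneg_of_nonneg hvn.ge hs)
    have hv' : v ∈ Submodule.span ℝ {k 0 0} := by rwa [range_unique] at hv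
    obtain ⟨c, rfl⟩ := Submodule.mem_span_singleton.1 hv'
    -- A null line lies in its own orthogonal complement, which is constant in `s`; hence `v` stays
    -- orthogonal to the null vector `k s 0` and cannot become timelike.
    have h1 := (hperp s (c • k 0 0)).2 (fun i ↦ by
      rw [Subsingleton.elim i 0, map_smul, hnull, smul_zero]) 0
    exact (hB.lorentz s).nonpos_of_orthogonal_null ((hli s).ne_zero 0) (hnull s 0) h1
  | p + 2 =>
    have hspace : ∀ s, ∃ w, B s w w < 0 := fun s ↦
      (hB.lorentz s).exists_spacelike ((hli s).ne_zero 0) (hnull s 0)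
    choose a ha using fun s ↦
      (hB.lorentz s).exists_mul_le (hB.deriv_symm s) (hB.nonneg s) (hspace s)
    let N : Submodule ℝ E := ⨅ i, LinearMap.ker (B 0 (k 0 i)).toLinearMap
    have hNmem : ∀ v, v ∈ N ↔ ∀ i, B 0 (k 0 i) v = 0 := fun v ↦ by simp [N]
    refine hB.null_of_timelike (W := fun s ↦ Submodule.span ℝ (range (k s))) (N := N) (a := a)
      (fun s v ↦ ?_) (fun s ↦ ?_) ha (fun s w hw v ↦ ?_) hv hvn hs
    · rw [hNmem, ← hperp s]
      refine ⟨fun h w hw ↦ ?_, fun h i ↦ h _ (Submodule.subset_span ⟨i, rfl⟩)⟩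
      induction hw using Submodule.span_induction with
      | mem x hx => obtain ⟨i, rfl⟩ := hx; exact h i
      | zero => simp
      | add x y _ _ hx hy => rw [map_add, add_apply, hx, hy, add_zero]
      | smul c x _ hx => rw [map_smul, smul_apply, hx, smul_zero]
    · have hpair : LinearIndependent ℝ ![k s 0, k s 1] := by
        have h2 := (hli s).comp ![0, 1] (by
          intro i j
          fin_cases i <;> fin_cases j <;> simp)
        convert h2 using 1
        ext i
        fin_cases i <;> rfl
      obtain ⟨c, hc⟩ := (hB.lorentz s).exists_timelike_add_smul hpair (hnull s 0) (hnull s 1)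
      exact ⟨_, Submodule.add_mem _ (Submodule.subset_span ⟨0, rfl⟩)
        (Submodule.smul_mem _ _ (Submodule.subset_span ⟨1, rfl⟩)), hc⟩
    · induction hw using Submodule.span_induction with
      | mem x hx =>
        obtain ⟨i, rfl⟩ := hx
        exact eq_mul_of_null (hB.lorentz s).symm (hB.deriv_symm s) (ha s) (hnull s i) (hD s i) v
      | zero => simp
      | add x y _ _ hx hy => simp only [map_add, add_apply, hx, hy, mul_add]
      | smul c x _ hx =>
        simp only [map_smul, smul_apply, hx, smul_eq_mul]
        ring

end IsExpandingCurve

end Curve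

/-! ### The pulled back metric as a curve of forms. -/

section Pullback

variable {E : Type*} [NormedAddCommGroup E] [NormedSpace ℝ E]
  {V : Type*} [TopologicalSpace V] [ChartedSpace E V] [IsManifold 𝓘(ℝ, E) ∞ V]
  {ξ : ∀ x : V, TangentSpace 𝓘(ℝ, E) x} {φ : ℝ → V → V}

set_option synthInstance.maxHeartbeats 200000

/-- Order `1` serves the pulled back metric; order `0` serves pairings with the time orientation,
which is only continuous. -/
theorem LorentzMetric.contDiff_form_apply (g : LorentzMetric E V) {n : WithTop ℕ∞} (hn : n ≤ 1)
    {c : ℝ → V} {u v : ∀ s, TangentSpace 𝓘(ℝ, E) (c s)}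
    (hu : ContMDiff 𝓘(ℝ, ℝ) 𝓘(ℝ, E).tangent n
      (fun s ↦ (⟨c s, u s⟩ : TangentBundle 𝓘(ℝ, E) V)))
    (hv : ContMDiff 𝓘(ℝ, ℝ) 𝓘(ℝ, E).tangent n
      (fun s ↦ (⟨c s, v s⟩ : TangentBundle 𝓘(ℝ, E) V))) :
    ContDiff ℝ n (fun s ↦ g.form (c s) (u s) (v s)) := by
  have : IsManifold 𝓘(ℝ, E) 1 V := IsManifold.of_le (n := ∞) (by simp)
  rw [← contMDiff_iff_contDiff]
  intro s
  have hc : ContMDiffAt 𝓘(ℝ, ℝ) 𝓘(ℝ, E) n c s :=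
    (Bundle.contMDiffAt_totalSpace.1 (hu s)).1
  have hg := ContMDiffAt.comp s ((g.contMDiff_form.of_le hn) (c s)) hc
  have h : ContMDiffAt 𝓘(ℝ, ℝ) (𝓘(ℝ, E).prod 𝓘(ℝ)) n
      (fun s ↦ Bundle.TotalSpace.mk' ℝ (E := Bundle.Trivial V ℝ) (c s)
        (g.form (c s) (u s) (v s))) s :=
    ContMDiffAt.clm_bundle_apply₂ (F₁ := E) (F₂ := E) hg (hu s) (hv s)
  simp only [Bundle.contMDiffAt_totalSpace] at h
  exact h.2

/-- The differentials of a smooth one-parameter family of maps, applied to a fixed vector, form a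
smooth curve in the tangent bundle. -/
theorem contMDiff_push {m n : WithTop ℕ∞} (hmn : m + 1 ≤ n)
    (hφ : ContMDiff (𝓘(ℝ, ℝ).prod 𝓘(ℝ, E)) 𝓘(ℝ, E) n (Function.uncurry φ)) (x : V)
    (u : TangentSpace 𝓘(ℝ, E) x) :
    ContMDiff 𝓘(ℝ, ℝ) 𝓘(ℝ, E).tangent m
      (fun s ↦ (⟨φ s x, push (φ s) x u⟩ : TangentBundle 𝓘(ℝ, E) V)) := by
  have : IsManifold 𝓘(ℝ, E) 1 V := IsManifold.of_le (n := ∞) (by simp)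
  intro s₀
  have hcurve : ContMDiffAt 𝓘(ℝ, ℝ) 𝓘(ℝ, E) n (fun s ↦ φ s x) s₀ :=
    ContMDiffAt.comp (I' := 𝓘(ℝ, ℝ).prod 𝓘(ℝ, E)) (g := Function.uncurry φ) s₀
      (hφ (s₀, x)) (contMDiffAt_id.prodMk contMDiffAt_const)
  have hmle : m ≤ n := le_self_add.trans hmn
  refine Bundle.contMDiffAt_totalSpace.2 ⟨hcurve.of_le hmle, ?_⟩
  have h := ContMDiffAt.mfderiv (J := 𝓘(ℝ, ℝ)) (x₀ := s₀) φ (fun _ ↦ x) (hφ (s₀, x))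
    contMDiffAt_const hmn
  have h2 : ContMDiffAt 𝓘(ℝ, ℝ) 𝓘(ℝ, E) m (fun s ↦ inTangentCoordinates 𝓘(ℝ, E) 𝓘(ℝ, E)
      (fun _ ↦ x) (fun s ↦ φ s x) (fun s ↦ mfderiv 𝓘(ℝ, E) 𝓘(ℝ, E) (φ s) x) s₀ s (u : E)) s₀ :=
    h.clm_apply contMDiffAt_const
  refine h2.congr_of_eventuallyEq ?_
  have hsrc : ∀ᶠ s in 𝓝 s₀, φ s x ∈ (chartAt E (φ s₀ x)).source :=
    hcurve.continuousAt.eventually ((chartAt E (φ s₀ x)).open_source.mem_nhds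
      (mem_chart_source E (φ s₀ x)))
  filter_upwards [hsrc] with s hs
  have h3 : (tangentBundleCore 𝓘(ℝ, E) V).coordChange (achart E x) (achart E x) x (u : E) = u :=
    (tangentBundleCore 𝓘(ℝ, E) V).coordChange_self (achart E x) x (mem_chart_source E x) u
  have h4 := inTangentCoordinates_eq (I := 𝓘(ℝ, E)) (I' := 𝓘(ℝ, E)) (fun _ ↦ x) (fun s ↦ φ s x)
    (fun s ↦ mfderiv 𝓘(ℝ, E) 𝓘(ℝ, E) (φ s) x) (x₀ := s₀) (mem_chart_source E x) hs
  have h5 := congrArg (fun A : E →L[ℝ] E ↦ A u) h4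
  exact (h5.trans (congrArg (fun w : E ↦ (tangentBundleCore 𝓘(ℝ, E) V).coordChange
    (achart E (φ s x)) (achart E (φ s₀ x)) (φ s x) (push (φ s) x w)) h3)).symm

/-- The metric at `φ_s(x)` pulled back to the tangent space at `x`. -/
noncomputable def pullForm (g : LorentzMetric E V) (φ : ℝ → V → V) (x : V) (s : ℝ) :
    E →L[ℝ] E →L[ℝ] ℝ :=
  let b : E →L[ℝ] E →L[ℝ] ℝ := g.form (φ s x)
  let A : E →L[ℝ] E := push (φ s) x
  b.bilinearComp A A

theorem pullForm_apply (g : LorentzMetric E V) (φ : ℝ → V → V) (x : V) (s : ℝ)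
    (u v : TangentSpace 𝓘(ℝ, E) x) : pullForm g φ x s u v =
      g.form (φ s x) (push (φ s) x u) (push (φ s) x v) := rfl

theorem LorentzMetric.isLorentzForm (g : LorentzMetric E V) (x : V) :
    IsLorentzForm (show E →L[ℝ] E →L[ℝ] ℝ from g.form x) :=
  ⟨g.symm x, g.lorentzian x⟩

/-- A complete smooth vector field with its flow. -/
structure IsSmoothFlow (ξ : ∀ x : V, TangentSpace 𝓘(ℝ, E) x) (φ : ℝ → V → V) : Prop where
  contMDiff_field : ContMDiff 𝓘(ℝ, E) 𝓘(ℝ, E).tangent ∞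
    (fun x ↦ (⟨x, ξ x⟩ : TangentBundle 𝓘(ℝ, E) V))
  isFlow : IsFlow ξ φ

namespace IsSmoothFlow

theorem map_zero (h : IsSmoothFlow ξ φ) (x : V) : φ 0 x = x := h.isFlow.map_zero x

theorem pullForm_zero (h : IsSmoothFlow ξ φ) (g : LorentzMetric E V) (x : V) :
    pullForm g φ x 0 = g.form x := by
  have h0 : φ 0 = id := funext h.map_zero
  ext u v
  change g.form (φ 0 x) (push (φ 0) x u) (push (φ 0) x v) = _
  rw [h0, push, mfderiv_id]
  rfl

variable [T2Space V] [FiniteDimensional ℝ E]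

theorem contMDiff_uncurry (h : IsSmoothFlow ξ φ) :
    ContMDiff (𝓘(ℝ, ℝ).prod 𝓘(ℝ, E)) 𝓘(ℝ, E) ∞ (Function.uncurry φ) :=
  h.isFlow.contMDiff_uncurry h.contMDiff_field

theorem contMDiff (h : IsSmoothFlow ξ φ) (s : ℝ) : ContMDiff 𝓘(ℝ, E) 𝓘(ℝ, E) ∞ (φ s) :=
  h.isFlow.contMDiff_time h.contMDiff_field s

theorem map_add (h : IsSmoothFlow ξ φ) (s t : ℝ) (x : V) : φ (s + t) x = φ s (φ t x) :=
  have : CompleteSpace E := FiniteDimensional.complete ℝ E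
  h.isFlow.map_add h.contMDiff_field s t x

/-- The time `s` map of the flow as a diffeomorphism. -/
def diffeomorph (h : IsSmoothFlow ξ φ) (s : ℝ) : V ≃ₘ^∞⟮𝓘(ℝ, E), 𝓘(ℝ, E)⟯ V where
  toFun := φ s
  invFun := φ (-s)
  left_inv x := by rw [← h.map_add, neg_add_cancel, h.map_zero]
  right_inv x := by rw [← h.map_add, add_neg_cancel, h.map_zero]
  contMDiff_toFun := h.contMDiff s
  contMDiff_invFun := h.contMDiff (-s)

theorem push_bijective (h : IsSmoothFlow ξ φ) (s : ℝ) (x : V) :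
    Function.Bijective (push (E := E) (φ s) x) :=
  ((h.diffeomorph s).mfderivToContinuousLinearEquiv (by simp) x).bijective

theorem push_ne_zero (h : IsSmoothFlow ξ φ) (s : ℝ) {x : V} {u : TangentSpace 𝓘(ℝ, E) x}
    (hu : u ≠ 0) : push (φ s) x u ≠ 0 := fun h0 ↦
  hu ((h.push_bijective s x).1 (h0.trans (ContinuousLinearMap.map_zero _).symm))

theorem pullForm_add (h : IsSmoothFlow ξ φ) (g : LorentzMetric E V) (x : V) (s t : ℝ)
    (u v : TangentSpace 𝓘(ℝ, E) x) : pullForm g φ x (s + t) u v =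
      pullForm g φ (φ t x) s (push (φ t) x u) (push (φ t) x v) := by
  have h0 : φ (s + t) = φ s ∘ φ t := funext fun y ↦ h.map_add s t y
  rw [pullForm_apply, h0, push, mfderiv_comp x ((h.contMDiff s).mdifferentiableAt (by simp))
    ((h.contMDiff t).mdifferentiableAt (by simp))]
  rfl

theorem contDiff_pullForm (h : IsSmoothFlow ξ φ) (g : LorentzMetric E V) (x : V) :
    ContDiff ℝ 1 (pullForm g φ x) := by
  rw [contDiff_clm_apply_iff]
  intro u
  rw [contDiff_clm_apply_iff]
  intro v
  exact g.contDiff_form_apply le_rfl (contMDiff_push (by norm_cast) h.contMDiff_uncurry x u)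
    (contMDiff_push (by norm_cast) h.contMDiff_uncurry x v)

theorem isLorentzForm_pullForm (h : IsSmoothFlow ξ φ) (g : LorentzMetric E V) (x : V) (s : ℝ) :
    IsLorentzForm (pullForm g φ x s) := by
  obtain ⟨w, hw, hneg⟩ := g.lorentzian (φ s x)
  obtain ⟨u, rfl⟩ := (h.push_bijective s x).2 w
  have hneg' : ∀ v : TangentSpace 𝓘(ℝ, E) x, pullForm g φ x s u v = 0 → v ≠ 0 →
      pullForm g φ x s v v < 0 := fun v huv hv ↦ by
    rw [pullForm_apply] at huv ⊢
    exact hneg _ huv (h.push_ne_zero s hv)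
  have hpos : 0 < pullForm g φ x s u u := by
    rw [pullForm_apply]
    exact hw
  exact ⟨fun u v ↦ g.symm (φ s x) (push (φ s) x u) (push (φ s) x v), u, hpos, hneg'⟩

/-- The group law moves the derivative at time `s` to the derivative at time `0` based at `φ s x`.
-/
theorem deriv_pullForm (h : IsSmoothFlow ξ φ) (g : LorentzMetric E V) (x : V) (s : ℝ)
    (u v : TangentSpace 𝓘(ℝ, E) x) : deriv (pullForm g φ x) s u v =
      lieMetric g φ (φ s x) (push (φ s) x u) (push (φ s) x v) := by
  have h1 : HasDerivAt (pullForm g φ x) (deriv (pullForm g φ x) s) s :=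
    ((h.contDiff_pullForm g x).differentiable (by simp) s).hasDerivAt
  have h3 : HasDerivAt (fun r ↦ pullForm g φ x r u v) (deriv (pullForm g φ x) s u v) (0 + s) := by
    rw [zero_add]
    exact hasDerivAt_bilin_apply h1 u v
  have h4 := h3.comp_add_const 0 s
  have h5 : (fun r ↦ pullForm g φ x (r + s) u v) = fun r ↦
      g.form (φ r (φ s x)) (push (φ r) (φ s x) (push (φ s) x u))
        (push (φ r) (φ s x) (push (φ s) x v)) :=
    funext fun r ↦ h.pullForm_add g x r s u v
  rw [h5] at h4
  exact h4.deriv.symm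

end IsSmoothFlow

end Pullback

/-! ### Causal symmetries and canonical null directions. -/

section Main

variable {E : Type*} [NormedAddCommGroup E] [NormedSpace ℝ E]
  {V : Type*} [TopologicalSpace V] [ChartedSpace E V] [IsManifold 𝓘(ℝ, E) ∞ V]
  {ξ : ∀ x : V, TangentSpace 𝓘(ℝ, E) x} {φ : ℝ → V → V} {g : LorentzMetric E V}
  {τ : TimeOrientation g}

set_option synthInstance.maxHeartbeats 200000

/-- Either `k` or `-k` is future directed when `k ≠ 0`, and the quadratic form does not see the
sign. -/
theorem lieMetric_nonneg_of_isFutureTensor {x : V} {a : ℝ}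
    (h : IsFutureTensor g τ x fun u v ↦ lieMetric g φ x u v - a * g.form x u v)
    {k : TangentSpace 𝓘(ℝ, E) x} (hk : g.form x k k = 0) : 0 ≤ lieMetric g φ x k k := by
  rcases eq_or_ne k 0 with rfl | hk0
  · simp [lieMetric]
  have hne : g.form x (τ.field x) k ≠ 0 :=
    (g.isLorentzForm x).ne_zero_of_causal (τ.timelike x) hk.ge hk0
  rcases hne.lt_or_gt with hlt | hgt
  · have hneg : IsFutureDirected g τ x (-k) :=
      ⟨by simp [hk], by rw [map_neg]; linarith⟩
    have h1 := h _ _ hneg hneg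
    simpa [hk, lieMetric] using h1
  · have h1 := h k k ⟨hk.ge, hgt⟩ ⟨hk.ge, hgt⟩
    simpa [hk] using h1

namespace IsSmoothFlow

variable [T2Space V] [FiniteDimensional ℝ E]

theorem isExpandingCurve_pullForm (h : IsSmoothFlow ξ φ)
    (hnonneg : ∀ (x : V) (k : TangentSpace 𝓘(ℝ, E) x), g.form x k k = 0 →
      0 ≤ lieMetric g φ x k k) (x : V) : IsExpandingCurve (pullForm g φ x) where
  contDiff := h.contDiff_pullForm g x
  lorentz := h.isLorentzForm_pullForm g x
  nonneg s k hk := by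
    rw [h.deriv_pullForm g x s k k]
    exact hnonneg _ _ hk

theorem isCausalSymmetry (h : IsSmoothFlow ξ φ) (τ : TimeOrientation g)
    (hnonneg : ∀ (x : V) (k : TangentSpace 𝓘(ℝ, E) x), g.form x k k = 0 →
      0 ≤ lieMetric g φ x k k) {s : ℝ} (hs : 0 ≤ s) : IsCausalSymmetry g τ (φ s) := by
  refine ⟨⟨h.diffeomorph s, rfl⟩, fun x v hv ↦ ?_⟩
  have hB := h.isExpandingCurve_pullForm hnonneg x
  have hcausal : ∀ r, 0 ≤ r → 0 ≤ g.form (φ r x) (push (φ r) x v) (push (φ r) x v) := by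
    intro r hr
    refine hB.nonneg_of_nonneg (v := v) ?_ hr
    rw [h.pullForm_zero g x]
    exact hv.1
  have hv0 : v ≠ 0 := fun h0 ↦ by
    have := hv.2
    simp [h0] at this
  set f : ℝ → ℝ := fun r ↦ g.form (φ r x) (τ.field (φ r x)) (push (φ r) x v) with hf
  -- A nonzero causal vector is never orthogonal to a timelike one, so the continuous function `f`
  -- cannot change sign.
  have hne : ∀ r, 0 ≤ r → f r ≠ 0 := fun r hr ↦
    (g.isLorentzForm (φ r x)).ne_zero_of_causal (τ.timelike (φ r x)) (hcausal r hr)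
      (h.push_ne_zero r hv0)
  have hcont : Continuous f := by
    have h1 : Continuous fun r ↦ (⟨φ r x, τ.field (φ r x)⟩ : TangentBundle 𝓘(ℝ, E) V) :=
      τ.continuous_field.comp (h.isFlow.isMIntegralCurve x).continuous
    exact (g.contDiff_form_apply (n := 0) zero_le_one (contMDiff_zero_iff.2 h1)
      (contMDiff_push (by norm_cast) h.contMDiff_uncurry x v)).continuous
  have h0 : 0 < f 0 := by
    have e : φ 0 = id := funext h.map_zero
    have e2 : f 0 = g.form x (τ.field x) v := by
      change g.form (φ 0 x) (τ.field (φ 0 x)) (push (φ 0) x v) = _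
      rw [e, push, mfderiv_id]
      rfl
    rw [e2]
    exact hv.2
  refine ⟨hcausal s hs, ?_⟩
  by_contra! hle
  obtain ⟨r, hr, hr0⟩ := intermediate_value_Icc' hs hcont.continuousOn ⟨hle, h0.le⟩
  exact hne r hr.1 hr0

theorem isCausalPreserving (h : IsSmoothFlow ξ φ) (τ : TimeOrientation g)
    (hnonneg : ∀ (x : V) (k : TangentSpace 𝓘(ℝ, E) x), g.form x k k = 0 →
      0 ≤ lieMetric g φ x k k) : IsCausalPreserving g τ ξ :=
  ⟨φ, h.isFlow, Ici 0, ordConnected_Ici, self_mem_Ici, ⟨1, by simp, one_pos⟩,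
    fun _ _ hs ↦ h.isCausalSymmetry τ hnonneg hs⟩

theorem canonicalNullDirections_subset (h : IsSmoothFlow ξ φ) {J : Set ℝ}
    (hJ : IsCausalSubmonoid g τ φ J) : canonicalNullDirections g φ J ⊆ muSet g φ := by
  obtain ⟨hord, h0J, ⟨ε, hεJ, hε⟩, -⟩ := hJ
  rintro ⟨x, k⟩ ⟨hk0, hk, hcan⟩
  refine ⟨hk0, hk, ?_⟩
  have h1 : HasDerivAt (fun r ↦ pullForm g φ x r k k) (lieMetric g φ x k k) 0 :=
    (hasDerivAt_bilin_apply ((h.contDiff_pullForm g x).differentiable (by simp) 0).hasDerivAt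
      k k).differentiableAt.hasDerivAt
  -- Only times `s ≥ 0` are available, so the derivative is compared from the right.
  have h2 : HasDerivWithinAt (fun r ↦ pullForm g φ x r k k) 0 (Ici 0) 0 := by
    refine (hasDerivWithinAt_const (0 : ℝ) (Ici 0) (0 : ℝ)).congr_of_eventuallyEq ?_
      (hcan 0 h0J le_rfl)
    filter_upwards [Icc_mem_nhdsGE hε] with r hr
    exact hcan r (hord.out h0J hεJ hr) hr.1
  exact (uniqueDiffOn_Ici (0 : ℝ) 0 self_mem_Ici).eq_deriv _ h1.hasDerivWithinAt h2

theorem null_push_of_mem_muSet (h : IsSmoothFlow ξ φ)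
    (hnonneg : ∀ (x : V) (k : TangentSpace 𝓘(ℝ, E) x), g.form x k k = 0 →
      0 ≤ lieMetric g φ x k k) {p : ℕ}
    {Ω : ∀ x : V, TangentSpace 𝓘(ℝ, E) x [⋀^Fin p]→L[ℝ] ℝ} (hΩ : IsWedgeOfMu g φ Ω)
    (hlie : LieProportional φ Ω) {x : V} {v : TangentSpace 𝓘(ℝ, E) x}
    (hv : (⟨x, v⟩ : TangentBundle 𝓘(ℝ, E) V) ∈ muSet g φ) {s : ℝ} (hs : 0 ≤ s) :
    g.form (φ s x) (push (φ s) x v) (push (φ s) x v) = 0 := by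
  have hB := h.isExpandingCurve_pullForm hnonneg x
  choose K hKmu hKli hKmax hKdet using hΩ
  obtain ⟨β, hβ⟩ := hlie
  -- The families at the points `φ s x` are pulled back to `T_xV`. They may depend on `s` without
  -- any continuity; only their orthogonal complement is tracked, as the kernel of `c s = φ_s^* Ω`.
  choose k hk using fun s i ↦ (h.push_bijective s x).2 (K (φ s x) i)
  let c : ℝ → (Fin p → E) → ℝ := fun s w ↦ Ω (φ s x) fun i ↦ push (φ s) x (w i)
  have hc : ∀ s w, c s w = (Matrix.of fun l j ↦ pullForm g φ x s (k s l) (w j)).det := by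
    intro s w
    refine (hKdet (φ s x) _).trans ?_
    congr 2
    funext l j
    rw [← hk s l]
    rfl
  have hcd : ∀ s w, HasDerivAt (fun s ↦ c s w) (β (φ s x) * c s w) s := by
    intro s w
    have h1 := hβ (φ s x) fun i ↦ push (φ s) x (w i)
    have h2 : (fun r ↦ Ω (φ r (φ s x)) fun i ↦ push (φ r) (φ s x) (push (φ s) x (w i))) =
        fun r ↦ c (r + s) w := by
      funext r
      have e : φ (r + s) = φ r ∘ φ s := funext fun y ↦ h.map_add r s y
      change _ = Ω (φ (r + s) x) fun i ↦ push (φ (r + s)) x (w i)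
      have e' : push (E := E) (φ r ∘ φ s) x = (push (φ r) (φ s x)).comp (push (φ s) x) :=
        mfderiv_comp x ((h.contMDiff r).mdifferentiableAt (by simp))
          ((h.contMDiff s).mdifferentiableAt (by simp))
      rw [e]
      exact congrArg (fun A : TangentSpace 𝓘(ℝ, E) x →L[ℝ] TangentSpace 𝓘(ℝ, E) (φ r (φ s x)) ↦
        Ω (φ r (φ s x)) fun i ↦ A (w i)) e'.symm
    rw [h2, ← sub_self s] at h1
    simpa using h1.comp_sub_const s s
  have hli : ∀ s, LinearIndependent ℝ (k s) := fun s ↦ by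
    refine LinearIndependent.of_comp (push (φ s) x).toLinearMap ?_
    have : (push (φ s) x).toLinearMap ∘ k s = K (φ s x) := funext (hk s)
    rw [this]
    exact hKli _
  have hne : ∀ s, ∃ w, c s w ≠ 0 := fun s ↦ by
    obtain ⟨w, hw⟩ := (hB.lorentz s).exists_det_ne_zero (hli s)
    exact ⟨w, by rwa [hc]⟩
  have hker : ∀ s (u : E), (∀ i, pullForm g φ x s (k s i) u = 0) ↔
      ∀ w i, c s (Function.update w i u) = 0 := fun s u ↦ by
    rw [← (hB.lorentz s).forall_det_update_eq_zero_iff (hli s) u]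
    simp only [hc]
  have hspan : v ∈ Submodule.span ℝ (range (k 0)) := by
    have e : φ 0 = id := funext h.map_zero
    have hv' : (⟨φ 0 x, push (φ 0) x v⟩ : TangentBundle 𝓘(ℝ, E) V) ∈ muSet g φ := by
      have e2 : (⟨φ 0 x, push (φ 0) x v⟩ : TangentBundle 𝓘(ℝ, E) V) = ⟨x, v⟩ := by
        rw [e, push, mfderiv_id]
        rfl
      rwa [e2]
    have h1 := hKmax (φ 0 x) _ hv'
    have h2 : K (φ 0 x) = (push (φ 0) x).toLinearMap ∘ k 0 := (funext (hk 0)).symm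
    rw [h2, range_comp, Submodule.span_image] at h1
    obtain ⟨v', hv'mem, hv'eq⟩ := h1
    rwa [← (h.push_bijective 0 x).1 hv'eq]
  refine hB.null_of_mem_span (k := k) hli (fun s i ↦ ?_) (fun s i ↦ ?_) (fun s u ↦ ?_) hspan hv.1
    ?_ hs
  · rw [pullForm_apply, hk]
    exact (hKmu (φ s x) i).2.1
  · rw [h.deriv_pullForm, hk]
    exact (hKmu (φ s x) i).2.2
  · rw [hker, hker]
    exact forall₂_congr fun w i ↦ ⟨fun hz ↦ eq_zero_of_deriv_eq_mul hcd hne hz 0,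
      fun hz ↦ eq_zero_of_deriv_eq_mul hcd hne hz s⟩
  · rw [h.pullForm_zero]
    exact hv.2.1

end IsSmoothFlow

end Main

end CausalSym

theorem theorem7p1 {E : Type*} [NormedAddCommGroup E] [NormedSpace ℝ E] [FiniteDimensional ℝ E]
    {V : Type*} [TopologicalSpace V] [T2Space V] [ChartedSpace E V]
    [IsManifold (modelWithCornersSelf ℝ E) (⊤ : ℕ∞) V]
    (g : CausalSym.LorentzMetric E V) (τ : CausalSym.TimeOrientation g)
    (ξ : ∀ x : V, TangentSpace (modelWithCornersSelf ℝ E) x)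
    (_hξ : ContMDiff (modelWithCornersSelf ℝ E) (modelWithCornersSelf ℝ E).tangent (⊤ : ℕ∞)
      (fun x ↦ (⟨x, ξ x⟩ : TangentBundle (modelWithCornersSelf ℝ E) V)))
    (φ : ℝ → V → V) (_hφ : CausalSym.IsFlow ξ φ)
    (α : V → ℝ)
    (_hfuture : ∀ x, CausalSym.IsFutureTensor g τ x
      (fun u v ↦ CausalSym.lieMetric g φ x u v - α x * g.form x u v))
    (_htype : ∀ x y, CausalSym.SameAlgebraicType g x y
      (fun u v ↦ CausalSym.lieMetric g φ x u v - α x * g.form x u v)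
      (fun u v ↦ CausalSym.lieMetric g φ y u v - α y * g.form y u v)) :
    (CausalSym.muSet g φ = ∅ →
      CausalSym.IsCausalPreserving g τ ξ ∧
      ∀ J, CausalSym.IsCausalSubmonoid g τ φ J →
        CausalSym.canonicalNullDirections g φ J = ∅) ∧
    (CausalSym.muSet g φ ≠ ∅ →
      ∀ (p : ℕ) (Ω : ∀ x : V, TangentSpace (modelWithCornersSelf ℝ E) x [⋀^Fin p]→L[ℝ] ℝ),
        CausalSym.IsWedgeOfMu g φ Ω → CausalSym.LieProportional φ Ω →
        CausalSym.IsCausalPreserving g τ ξ ∧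
        ∀ J, CausalSym.IsCausalSubmonoid g τ φ J →
          CausalSym.canonicalNullDirections g φ J = CausalSym.muSet g φ) := by
  have h : CausalSym.IsSmoothFlow ξ φ := ⟨_hξ, _hφ⟩
  have hnonneg : ∀ (x : V) (k : TangentSpace (modelWithCornersSelf ℝ E) x), g.form x k k = 0 →
      0 ≤ CausalSym.lieMetric g φ x k k := fun x _ hk ↦
    CausalSym.lieMetric_nonneg_of_isFutureTensor (_hfuture x) hk
  refine ⟨fun hμ ↦ ⟨h.isCausalPreserving τ hnonneg, fun J hJ ↦ ?_⟩,
    fun _ p Ω hΩ hlie ↦ ⟨h.isCausalPreserving τ hnonneg, fun J hJ ↦ ?_⟩⟩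
  · exact Set.subset_eq_empty (h.canonicalNullDirections_subset hJ) hμ
  · refine (h.canonicalNullDirections_subset hJ).antisymm ?_
    rintro ⟨x, v⟩ hv
    exact ⟨hv.1, hv.2.1, fun s _ hs ↦ h.null_push_of_mem_muSet hnonneg hΩ hlie hv hs⟩
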